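/- Let $\mathbb{k}$ be a field of characteristic zero. Let $A$ be a commutative constraint algebra, i.e. a commutative $\mathbb{k}$-algebra $A=A_T$ (ungraded) with a unital subalgebra $A_W\subseteq A_T$ and an ideal $A_N$ of $A_W$. Let $\mathfrak L$ be a constraint Lie–Rinehart algebra over $A$: a Lie–Rinehart algebra $\mathfrak L=\mathfrak L_T$ over $A_T$, whose anchor we write $x\mapsto (f\mapsto x(f))$, with subspaces $\mathfrak L_N\subseteq\mathfrak L_W\subseteq\mathfrak L_T$ such that $A_W\mathfrak L_W\subseteq\mathfrak L_W$, $A_N\mathfrak L_W+A_W\mathfrak L_N\subseteq\mathfrak L_N$, $[\mathfrak L_W,\mathfrak L_W]\subseteq\mathfrak L_W$, $[\mathfrak L_W,\mathfrak L_N]\subseteq\mathfrak L_N$, $\mathfrak L_W(A_W)\subseteq A_W$, $\mathfrak L_W(A_N)\subseteq A_N$ and $\mathfrak L_N(A_W)\subseteq A_N$. Let $\Lambda=\Lambda_A\mathfrak L$ be the exterior algebra of $\mathfrak L_T$ over $A_T$, graded by exterior degree; let $\Lambda^n_W$ be the image of $\Lambda^n_{A_W}\mathfrak L_W$ in $\Lambda^n$,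 and let $\Lambda^n_N\subseteq \Lambda^n_W$ be the span of the products $f\,x_1\wedge\dots\wedge x_n$ with $f\in A_W$, $x_i\in\mathfrak L_W$ and $f\in A_N$ or some $x_i\in\mathfrak L_N$ (so $\Lambda^0_N=A_N$). Let $\mathrm{CE}(\mathfrak L)=((\Lambda_A\mathfrak L)^*)^{\mathrm{rev}}$, i.e. $\mathrm{CE}^n=\mathrm{Hom}_A(\Lambda^n,A)$ with $\mathrm{CE}^n_W=\{\alpha:\alpha(\Lambda^n_W)\subseteq A_W,\ \alpha(\Lambda^n_N)\subseteq A_N\}$ and $\mathrm{CE}^n_N=\{\alpha:\alpha(\Lambda^n_W)\subseteq A_N\}$. Then the following hold. (1) There is a unique $\mathbb{k}$-bilinear bracket $\{\cdot,\cdot\}$ on $\Lambda$ (the Schouten–Nijenhuis bracket) with $\{f,g\}=0$, $$\{f,x_1\wedge\dots\wedge x_m\}=-\sum_i(-1)^{i+1}x_i(f)\,x_1\wedge\dots\widehat{x_i}\dots\wedge x_m=(-1)^m\{x_1\wedge\dots\wedge x_m,f\},$$ $$\{x_1\wedge\dots\wedge x_m,y_1\wedge\dots\wedge y_n\}=\sum_{i,j}(-1)^{i+j}[x_i,y_j]\wedge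 x_1\wedge\dots\widehat{x_i}\dots\wedge x_m\wedge y_1\wedge\dots\widehat{y_j}\dots\wedge y_n$$ for $f,g\in A$, $m,n\ge1$, $x_i,y_j\in\mathfrak L$; and a unique $\mathbb{k}$-linear map $d=d_{\mathrm{CE}}$ on $\mathrm{CE}(\mathfrak L)$ given, for $\alpha\in \mathrm{CE}^k$, by the Chevalley–Eilenberg formula $$d\alpha(x_1\wedge\dots\wedge x_{k+1})=\sum_i(-1)^{i+1}x_i\big(\alpha(x_1\wedge\dots\widehat{x_i}\dots\wedge x_{k+1})\big)+\sum_{i<j}(-1)^{i+j}\alpha\big([x_i,x_j]\wedge x_1\wedge\dots\widehat{x_i}\dots\widehat{x_j}\dots\wedge x_{k+1}\big).$$ (2) $(\Lambda,\wedge,\{\cdot,\cdot\})$ is a constraint Gerstenhaber algebra: the product is unital, associative and graded commutative, $\{\cdot,\cdot\}$ is a graded Lie bracket on $\Lambda[1]$, $\{a,b\wedge c\}=\{a,b\}\wedge c+(-1)^{(|a|-1)|b|}b\wedge\{a,c\}$; moreover $1\in\Lambda^0_W$, and both operations map $\Lambda_W\times\Lambda_W$ to $\Lambda_W$ and $\Lambda_N\times\Lambda_W$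 and $\Lambda_W\times\Lambda_N$ to $\Lambda_N$. (3) Put $\iota_f\alpha=f\alpha$ for $f\in A$, $(\iota_x\alpha)(y)=\alpha(x\wedge y)$ for $x\in\mathfrak L$, $\iota_{x_1\wedge\dots\wedge x_k}=\iota_{x_1}\cdots\iota_{x_k}$, and $\mathcal L_a=\iota_a d-(-1)^{|a|}d\,\iota_a$. Then $(\mathrm{CE}(\mathfrak L),\iota,\mathcal L,d)$ is a constraint BV-module (noncommutative differential calculus) over $\Lambda$: $d$, $\iota_a$ and $\mathcal L_a$ have degrees $1$, $-|a|$ and $1-|a|$, and, for homogeneous $a,b$ and with graded commutators, $$d^2=0,\quad \iota_1=\mathrm{id},\quad \iota_{a\wedge b}=\iota_a\iota_b,\quad \mathcal L_a=[\iota_a,d],\quad \mathcal L_{\{a,b\}}=[\mathcal L_a,\mathcal L_b],$$ $$\iota_{\{a,b\}}=[\mathcal L_a,\iota_b]=(-1)^{|b|-1}[\iota_a,\mathcal L_b],\quad \mathcal L_{a\wedge b}=\iota_a\mathcal L_b+(-1)^{|b|}\mathcal L_a\iota_b;$$ moreover $d$ maps $\mathrm{CE}_W$ to $\mathrm{CE}_W$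 and $\mathrm{CE}_N$ to $\mathrm{CE}_N$, and both $\iota$ and $\mathcal L$ map $\Lambda_W\times\mathrm{CE}_W$ to $\mathrm{CE}_W$, and $\Lambda_N\times \mathrm{CE}_W$ and $\Lambda_W\times\mathrm{CE}_N$ to $\mathrm{CE}_N$. -/

import Mathlib

/-! ### Constraint graded vector spaces -/

/-- An (embedded, `ℤ`-graded) constraint vector space: a vector space `V` which is the direct sum
of its homogeneous components `T i`, with subspaces `N i ≤ W i ≤ T i` in every degree. -/
structure ConstraintGradedSpace (𝕜 V : Type*) [Field 𝕜] [AddCommGroup V] [Module 𝕜 V] where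
  T : ℤ → Submodule 𝕜 V
  W : ℤ → Submodule 𝕜 V
  N : ℤ → Submodule 𝕜 V
  isInternal : DirectSum.IsInternal T
  W_le_T : ∀ i, W i ≤ T i
  N_le_W : ∀ i, N i ≤ W i

/-! ### Gerstenhaber algebras -/

section Gerstenhaber

variable {𝕜 G : Type*} [Field 𝕜] [Ring G] [Algebra 𝕜 G]

/-- The unital algebra `G`, graded by `T`, is a Gerstenhaber algebra with bracket `br`:
the product is graded commutative, `br` is a graded Lie bracket on `G[1]`, and every `br a` with
`a` of degree `i` is a derivation of degree `i - 1` of the product. -/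
structure IsGerstenhaberAlgebra (T : ℤ → Submodule 𝕜 G) (br : G →ₗ[𝕜] G →ₗ[𝕜] G) : Prop where
  isInternal : DirectSum.IsInternal T
  one_mem : (1 : G) ∈ T 0
  mul_mem : ∀ i j, ∀ a ∈ T i, ∀ b ∈ T j, a * b ∈ T (i + j)
  mul_comm : ∀ i j, ∀ a ∈ T i, ∀ b ∈ T j, a * b = (i * j).negOnePow • (b * a)
  br_mem : ∀ i j, ∀ a ∈ T i, ∀ b ∈ T j, br a b ∈ T (i + j - 1)
  br_antisymm : ∀ i j, ∀ a ∈ T i, ∀ b ∈ T j,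
    br a b = -(((i - 1) * (j - 1)).negOnePow • br b a)
  jacobi : ∀ i j k, ∀ a ∈ T i, ∀ b ∈ T j, ∀ c ∈ T k,
    br a (br b c) = br (br a b) c + ((i - 1) * (j - 1)).negOnePow • br b (br a c)
  leibniz : ∀ i j k, ∀ a ∈ T i, ∀ b ∈ T j, ∀ c ∈ T k,
    br a (b * c) = br a b * c + ((i - 1) * j).negOnePow • (b * br a c)

/-- A constraint Gerstenhaber algebra: product and bracket are constraint morphisms (for the weak
tensor product), the unit lies in the `W`-component, and the total component is a Gerstenhaber
algebra. -/
structure IsConstraintGerstenhaberAlgebra (C : ConstraintGradedSpace 𝕜 G)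
    (br : G →ₗ[𝕜] G →ₗ[𝕜] G) : Prop where
  total : IsGerstenhaberAlgebra C.T br
  one_mem_W : (1 : G) ∈ C.W 0
  mul_mem_W : ∀ i j, ∀ a ∈ C.W i, ∀ b ∈ C.W j, a * b ∈ C.W (i + j)
  mul_mem_N_left : ∀ i j, ∀ a ∈ C.N i, ∀ b ∈ C.W j, a * b ∈ C.N (i + j)
  mul_mem_N_right : ∀ i j, ∀ a ∈ C.W i, ∀ b ∈ C.N j, a * b ∈ C.N (i + j)
  br_mem_W : ∀ i j, ∀ a ∈ C.W i, ∀ b ∈ C.W j, br a b ∈ C.W (i + j - 1)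
  br_mem_N_left : ∀ i j, ∀ a ∈ C.N i, ∀ b ∈ C.W j, br a b ∈ C.N (i + j - 1)
  br_mem_N_right : ∀ i j, ∀ a ∈ C.W i, ∀ b ∈ C.N j, br a b ∈ C.N (i + j - 1)

variable {V : Type*} [AddCommGroup V] [Module 𝕜 V]

/-- A Gerstenhaber module: an action `ι` of the associative algebra `G` (an element of degree `i`
acts with degree `-i`), an action `Lie` of the graded Lie algebra `G[1]` (an element of degree `i`
acts with degree `1 - i`), and `ι_{a,b} = [Lie_a, ι_b]`. -/
structure IsGerstenhaberModule (T : ℤ → Submodule 𝕜 G) (br : G →ₗ[𝕜] G →ₗ[𝕜] G)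
    (TV : ℤ → Submodule 𝕜 V) (ι Lie : G →ₗ[𝕜] Module.End 𝕜 V) : Prop where
  isInternal : DirectSum.IsInternal TV
  ι_mem : ∀ i j, ∀ a ∈ T i, ∀ v ∈ TV j, ι a v ∈ TV (j - i)
  ι_one : ι 1 = 1
  ι_mul : ∀ a b, ι (a * b) = ι a * ι b
  Lie_mem : ∀ i j, ∀ a ∈ T i, ∀ v ∈ TV j, Lie a v ∈ TV (j + 1 - i)
  Lie_br : ∀ i j, ∀ a ∈ T i, ∀ b ∈ T j,
    Lie (br a b) = Lie a * Lie b - ((i - 1) * (j - 1)).negOnePow • (Lie b * Lie a)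
  ι_br : ∀ i j, ∀ a ∈ T i, ∀ b ∈ T j,
    ι (br a b) = Lie a * ι b - ((i - 1) * j).negOnePow • (ι b * Lie a)

/-- A Batalin–Vilkovisky module (a noncommutative differential calculus): a Gerstenhaber module
with a differential `d` of degree `1` satisfying Cartan's formula `Lie_a = [ι_a, d]`, together with
the remaining rules `ι_{a,b} = (-1)^(|b|-1) [ι_a, Lie_b]` and
`Lie_(ab) = ι_a Lie_b + (-1)^|b| Lie_a ι_b` of the Cartan calculus. -/
structure IsBVModule (T : ℤ → Submodule 𝕜 G) (br : G →ₗ[𝕜] G →ₗ[𝕜] G)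
    (TV : ℤ → Submodule 𝕜 V) (ι Lie : G →ₗ[𝕜] Module.End 𝕜 V) (d : Module.End 𝕜 V) : Prop
    extends IsGerstenhaberModule T br TV ι Lie where
  d_mem : ∀ j, ∀ v ∈ TV j, d v ∈ TV (j + 1)
  d_d : d * d = 0
  cartan : ∀ i, ∀ a ∈ T i, Lie a = ι a * d - i.negOnePow • (d * ι a)
  ι_br' : ∀ i j, ∀ a ∈ T i, ∀ b ∈ T j,
    ι (br a b) = (j - 1).negOnePow • (ι a * Lie b - (i * (j - 1)).negOnePow • (Lie b * ι a))
  Lie_mul : ∀ i j, ∀ a ∈ T i, ∀ b ∈ T j,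
    Lie (a * b) = ι a * Lie b + j.negOnePow • (Lie a * ι b)

/-- A constraint BV-module over a constraint Gerstenhaber algebra: `ι`, `Lie` and `d` are constraint
morphisms, and the total component is a BV-module. -/
structure IsConstraintBVModule (C : ConstraintGradedSpace 𝕜 G) (br : G →ₗ[𝕜] G →ₗ[𝕜] G)
    (D : ConstraintGradedSpace 𝕜 V) (ι Lie : G →ₗ[𝕜] Module.End 𝕜 V) (d : Module.End 𝕜 V) :
    Prop where
  algebra : IsConstraintGerstenhaberAlgebra C br
  total : IsBVModule C.T br D.T ι Lie d
  ι_mem_W : ∀ i j, ∀ a ∈ C.W i, ∀ v ∈ D.W j, ι a v ∈ D.W (j - i)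
  ι_mem_N_left : ∀ i j, ∀ a ∈ C.N i, ∀ v ∈ D.W j, ι a v ∈ D.N (j - i)
  ι_mem_N_right : ∀ i j, ∀ a ∈ C.W i, ∀ v ∈ D.N j, ι a v ∈ D.N (j - i)
  Lie_mem_W : ∀ i j, ∀ a ∈ C.W i, ∀ v ∈ D.W j, Lie a v ∈ D.W (j + 1 - i)
  Lie_mem_N_left : ∀ i j, ∀ a ∈ C.N i, ∀ v ∈ D.W j, Lie a v ∈ D.N (j + 1 - i)
  Lie_mem_N_right : ∀ i j, ∀ a ∈ C.W i, ∀ v ∈ D.N j, Lie a v ∈ D.N (j + 1 - i)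
  d_mem_W : ∀ j, ∀ v ∈ D.W j, d v ∈ D.W (j + 1)
  d_mem_N : ∀ j, ∀ v ∈ D.N j, d v ∈ D.N (j + 1)

end Gerstenhaber

/-! ### Constraint algebras and constraint Lie–Rinehart algebras -/

/-- A constraint structure on the commutative algebra `A`: a unital subalgebra `W` and an ideal
`N` of `W`. -/
structure ConstraintAlgebra (𝕜 A : Type*) [Field 𝕜] [CommRing A] [Algebra 𝕜 A] where
  W : Subalgebra 𝕜 A
  N : Submodule 𝕜 A
  N_le_W : ∀ a ∈ N, a ∈ W
  mul_mem_N : ∀ a ∈ W, ∀ b ∈ N, a * b ∈ N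

/-- A constraint structure on the Lie–Rinehart algebra `(A, L)` over the constraint algebra
`(A, CA.W, CA.N)`: subspaces `N ≤ W` of `L` such that the module multiplication, the Lie bracket and
the anchor `x ↦ ⁅x, ·⁆` from `L` to the derivations of `A` are constraint morphisms. -/
structure ConstraintLieRinehart {𝕜 A : Type*} [Field 𝕜] [CommRing A] [Algebra 𝕜 A]
    (CA : ConstraintAlgebra 𝕜 A) (L : Type*) [LieRing L] [Module A L] [LieRingModule L A]
    [LieRinehartRing A L] [LieAlgebra 𝕜 L] [LieRinehartAlgebra 𝕜 A L] where
  W : Submodule 𝕜 L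
  N : Submodule 𝕜 L
  N_le_W : N ≤ W
  smul_mem_W : ∀ a ∈ CA.W, ∀ x ∈ W, a • x ∈ W
  smul_mem_N_left : ∀ a ∈ CA.N, ∀ x ∈ W, a • x ∈ N
  smul_mem_N_right : ∀ a ∈ CA.W, ∀ x ∈ N, a • x ∈ N
  lie_mem_W : ∀ x ∈ W, ∀ y ∈ W, ⁅x, y⁆ ∈ W
  lie_mem_N : ∀ x ∈ W, ∀ y ∈ N, ⁅x, y⁆ ∈ N
  anchor_W_mem_W : ∀ x ∈ W, ∀ a ∈ CA.W, ⁅x, a⁆ ∈ CA.W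
  anchor_W_mem_N : ∀ x ∈ W, ∀ a ∈ CA.N, ⁅x, a⁆ ∈ CA.N
  anchor_N_mem_N : ∀ x ∈ N, ∀ a ∈ CA.W, ⁅x, a⁆ ∈ CA.N

/-! ### `ℕ`-gradings as `ℤ`-gradings -/

/-- Extend a family of subspaces indexed by `ℕ` by zero in negative degrees. -/
def extendGrading {𝕜 V : Type*} [Field 𝕜] [AddCommGroup V] [Module 𝕜 V]
    (F : ℕ → Submodule 𝕜 V) : ℤ → Submodule 𝕜 V
  | Int.ofNat n => F n
  | Int.negSucc _ => ⊥

theorem extendGrading_mono {𝕜 V : Type*} [Field 𝕜] [AddCommGroup V] [Module 𝕜 V]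
    {F F' : ℕ → Submodule 𝕜 V} (h : ∀ n, F n ≤ F' n) (i : ℤ) :
    extendGrading F i ≤ extendGrading F' i := by
  cases i with
  | ofNat n => exact h n
  | negSucc n => exact le_rfl

theorem extendGrading_isInternal {𝕜 V : Type*} [Field 𝕜] [AddCommGroup V] [Module 𝕜 V]
    {F : ℕ → Submodule 𝕜 V} (h : DirectSum.IsInternal F) :
    DirectSum.IsInternal (extendGrading F) := by
  rw [DirectSum.isInternal_submodule_iff_iSupIndep_and_iSup_eq_top] at h ⊢
  refine ⟨?_, ?_⟩
  · rw [← iSupIndep_ne_bot]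
    have key : ∀ i : {i : ℤ // extendGrading F i ≠ ⊥},
        ∃ n : ℕ, (i : ℤ) = Int.ofNat n := by
      rintro ⟨i, hi⟩
      cases i with
      | ofNat n => exact ⟨n, rfl⟩
      | negSucc n => exact absurd rfl hi
    choose f hf using key
    have hinj : Function.Injective f := by
      intro a b hab
      apply Subtype.ext
      rw [hf a, hf b, hab]
    have := h.1.comp hinj
    convert this using 2 with i
    simp only [Function.comp]
    rw [hf i]
    rfl
  · rw [eq_top_iff, ← h.2]
    exact iSup_le fun n => le_iSup (extendGrading F) (Int.ofNat n)

/-! ### The constraint exterior algebra -/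

section Exterior

variable {𝕜 A : Type*} [Field 𝕜] [CommRing A] [Algebra 𝕜 A] {CA : ConstraintAlgebra 𝕜 A}
  {L : Type*} [LieRing L] [Module A L] [LieRingModule L A]
  [LieRinehartRing A L] [LieAlgebra 𝕜 L] [LieRinehartAlgebra 𝕜 A L]

namespace ConstraintLieRinehart

/-- The image of the `n`-th exterior power of `L_W` over `A_W` in the exterior algebra of `L`
over `A`. -/
def exteriorW (CL : ConstraintLieRinehart CA L) (n : ℕ) : Submodule 𝕜 (ExteriorAlgebra A L) :=
  Submodule.span 𝕜 {z | ∃ f ∈ CA.W, ∃ x : Fin n → L, (∀ i, x i ∈ CL.W) ∧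
    z = f • ExteriorAlgebra.ιMulti A n x}

/-- The subspace of `exteriorW` spanned by the products with at least one factor in a null
component. In degree `0` this is `A_N`, in positive degree it is the image of
`L_N ∧ Λ L_W`. -/
def exteriorN (CL : ConstraintLieRinehart CA L) (n : ℕ) : Submodule 𝕜 (ExteriorAlgebra A L) :=
  Submodule.span 𝕜 {z | ∃ f ∈ CA.W, ∃ x : Fin n → L, (∀ i, x i ∈ CL.W) ∧
    (f ∈ CA.N ∨ ∃ i, x i ∈ CL.N) ∧ z = f • ExteriorAlgebra.ιMulti A n x}

/-- The constraint exterior algebra of a constraint Lie–Rinehart algebra. -/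
def exterior (CL : ConstraintLieRinehart CA L) :
    ConstraintGradedSpace 𝕜 (ExteriorAlgebra A L) where
  T := extendGrading fun n => (⋀[A]^n L).restrictScalars 𝕜
  W := extendGrading CL.exteriorW
  N := extendGrading CL.exteriorN
  isInternal := by
    classical
    apply extendGrading_isInternal
    exact DirectSum.Decomposition.isInternal fun n : ℕ => ⋀[A]^n L
  W_le_T := by
    apply extendGrading_mono
    intro n
    refine Submodule.span_le.2 ?_
    rintro _ ⟨f, -, x, -, rfl⟩
    exact (⋀[A]^n L).smul_mem f (ExteriorAlgebra.ιMulti_range A n ⟨x, rfl⟩)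
  N_le_W := by
    apply extendGrading_mono
    intro n
    refine Submodule.span_mono ?_
    rintro _ ⟨f, hf, x, hx, -, rfl⟩
    exact ⟨f, hf, x, hx, rfl⟩

end ConstraintLieRinehart

/-- `br` is the Schouten–Nijenhuis bracket on the exterior algebra of the Lie–Rinehart algebra `L`:
it is given by the usual explicit formulas on functions and on products of elements of `L`. (The
functions and these products together span the exterior algebra.) -/
structure IsSchoutenNijenhuisBracket
    (br : ExteriorAlgebra A L →ₗ[𝕜] ExteriorAlgebra A L →ₗ[𝕜] ExteriorAlgebra A L) : Prop where
  apply_fun_fun : ∀ f g : A, br (algebraMap A _ f) (algebraMap A _ g) = 0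
  apply_fun : ∀ (f : A) (m : ℕ) (x : Fin (m + 1) → L),
    br (algebraMap A _ f) (ExteriorAlgebra.ιMulti A (m + 1) x) =
      -∑ i : Fin (m + 1), (-1 : ℤ) ^ (i : ℕ) •
        (⁅x i, f⁆ • ExteriorAlgebra.ιMulti A m fun l => x (i.succAbove l))
  apply_fun_right : ∀ (f : A) (m : ℕ) (x : Fin (m + 1) → L),
    br (ExteriorAlgebra.ιMulti A (m + 1) x) (algebraMap A _ f) =
      (-1 : ℤ) ^ (m + 1) • br (algebraMap A _ f) (ExteriorAlgebra.ιMulti A (m + 1) x)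
  apply_mul : ∀ (m n : ℕ) (x : Fin (m + 1) → L) (y : Fin (n + 1) → L),
    br (ExteriorAlgebra.ιMulti A (m + 1) x) (ExteriorAlgebra.ιMulti A (n + 1) y) =
      ∑ i : Fin (m + 1), ∑ j : Fin (n + 1), (-1 : ℤ) ^ ((i : ℕ) + (j : ℕ)) •
        (ExteriorAlgebra.ι A ⁅x i, y j⁆ *
          ExteriorAlgebra.ιMulti A m (fun l => x (i.succAbove l)) *
          ExteriorAlgebra.ιMulti A n (fun l => y (j.succAbove l)))

/-! ### The Chevalley–Eilenberg complex -/

section CEModule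

variable (A L : Type*) [CommRing A] [LieRing L] [Module A L]

/-- The `A`-linear functionals on the exterior algebra of `L` over `A` that vanish on all but
finitely many exterior powers. -/
def finiteFunctionals : Submodule A (ExteriorAlgebra A L →ₗ[A] A) where
  carrier := {φ | ∃ n : ℕ, ∀ m, n ≤ m → ∀ x ∈ ⋀[A]^m L, φ x = 0}
  zero_mem' := ⟨0, fun _ _ _ _ => rfl⟩
  add_mem' := by
    rintro φ ψ ⟨n, hn⟩ ⟨k, hk⟩
    refine ⟨max n k, fun m hm x hx => ?_⟩
    rw [LinearMap.add_apply, hn m (le_trans (le_max_left _ _) hm) x hx,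
      hk m (le_trans (le_max_right _ _) hm) x hx, add_zero]
  smul_mem' := by
    rintro a φ ⟨n, hn⟩
    refine ⟨n, fun m hm x hx => ?_⟩
    rw [LinearMap.smul_apply, hn m hm x hx, smul_zero]

/-- The underlying module of the Chevalley–Eilenberg complex, the direct sum of the `A`-duals of the
exterior powers of `L`, realized as `finiteFunctionals`. -/
def CEModule : Type _ := finiteFunctionals A L

instance : AddCommGroup (CEModule A L) := inferInstanceAs (AddCommGroup (finiteFunctionals A L))

instance : Module A (CEModule A L) := inferInstanceAs (Module A (finiteFunctionals A L))

instance {𝕜 : Type*} [Field 𝕜] [Algebra 𝕜 A] : Module 𝕜 (CEModule A L) :=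
  inferInstanceAs (Module 𝕜 (finiteFunctionals A L))

instance {𝕜 : Type*} [Field 𝕜] [Algebra 𝕜 A] : IsScalarTower 𝕜 A (CEModule A L) :=
  inferInstanceAs (IsScalarTower 𝕜 A (finiteFunctionals A L))

variable {A L}

/-- The functional on the exterior algebra underlying an element of the Chevalley–Eilenberg
complex. -/
def CEModule.toDual : CEModule A L →ₗ[A] (ExteriorAlgebra A L →ₗ[A] A) :=
  (finiteFunctionals A L).subtype

theorem CEModule.ext {φ ψ : CEModule A L} (h : ∀ z, φ.toDual z = ψ.toDual z) : φ = ψ :=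
  Subtype.ext (LinearMap.ext h)

/-- Insertion of an element of `L` into the leftmost slot: `(ι_x φ)(y) = φ (x ∧ y)`. -/
def CEInsert : L →ₗ[A] Module.End A (CEModule A L) where
  toFun x :=
    { toFun := fun φ => ⟨φ.toDual ∘ₗ LinearMap.mulLeft A (ExteriorAlgebra.ι A x), by
        obtain ⟨n, hn⟩ := φ.2
        refine ⟨n, fun m hm y hy => hn (m + 1) (by omega) _ ?_⟩
        rw [LinearMap.mulLeft_apply, ExteriorAlgebra.exteriorPower, pow_succ']
        exact Submodule.mul_mem_mul ⟨x, rfl⟩ hy⟩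
      map_add' := fun _ _ => rfl
      map_smul' := fun _ _ => rfl }
  map_add' x y := by
    refine LinearMap.ext fun φ => CEModule.ext fun z => ?_
    change φ.toDual (ExteriorAlgebra.ι A (x + y) * z) =
      φ.toDual (ExteriorAlgebra.ι A x * z) + φ.toDual (ExteriorAlgebra.ι A y * z)
    rw [map_add, add_mul, map_add]
  map_smul' a x := by
    refine LinearMap.ext fun φ => CEModule.ext fun z => ?_
    change φ.toDual (ExteriorAlgebra.ι A (a • x) * z) = a • φ.toDual (ExteriorAlgebra.ι A x * z)
    rw [map_smul, smul_mul_assoc, map_smul]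

theorem CEInsert_mul_self (x : L) : CEInsert (A := A) x * CEInsert x = 0 := by
  refine LinearMap.ext fun φ => CEModule.ext fun z => ?_
  change φ.toDual (ExteriorAlgebra.ι A x * (ExteriorAlgebra.ι A x * z)) = 0
  rw [← mul_assoc, ExteriorAlgebra.ι_sq_zero, zero_mul, map_zero]

/-- The contraction `ι_{x₁ ∧ ⋯ ∧ xₖ} = ι_{x₁} ∘ ⋯ ∘ ι_{xₖ}`, with `ι_f` the multiplication by `f` for
`f` in `A`, as an algebra homomorphism. -/
noncomputable def CEContractHom : ExteriorAlgebra A L →ₐ[A] Module.End A (CEModule A L) :=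
  ExteriorAlgebra.lift A ⟨CEInsert, CEInsert_mul_self⟩

end CEModule

variable (𝕜 A L) in
/-- The contraction as a `𝕜`-bilinear operation. -/
noncomputable def CEContract : ExteriorAlgebra A L →ₗ[𝕜] Module.End 𝕜 (CEModule A L) where
  toFun x := (CEContractHom x).restrictScalars 𝕜
  map_add' x y := by
    rw [map_add]
    rfl
  map_smul' c x := by
    refine LinearMap.ext fun φ => ?_
    rw [← algebraMap_smul A c x, map_smul]
    exact algebraMap_smul A c (CEContractHom x φ)

/-- `d` is the Chevalley–Eilenberg differential. -/
structure IsCEDifferential (d : Module.End 𝕜 (CEModule A L)) : Prop where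
  apply_one : ∀ φ, (d φ).toDual 1 = 0
  apply_one_vector : ∀ φ (x : L), (d φ).toDual (ExteriorAlgebra.ι A x) = ⁅x, φ.toDual 1⁆
  apply_vectors : ∀ φ (n : ℕ) (x : Fin (n + 2) → L),
    (d φ).toDual (ExteriorAlgebra.ιMulti A (n + 2) x) =
      (∑ i : Fin (n + 2), (-1 : ℤ) ^ (i : ℕ) •
        ⁅x i, φ.toDual (ExteriorAlgebra.ιMulti A (n + 1) fun l => x (i.succAbove l))⁆) +
      ∑ i : Fin (n + 1), ∑ j : Fin (n + 2), if i.castSucc < j then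
        (-1 : ℤ) ^ ((i : ℕ) + (j : ℕ)) •
          φ.toDual (ExteriorAlgebra.ι A ⁅x i.castSucc, x j⁆ *
            ExteriorAlgebra.ιMulti A n fun l => x (j.succAbove (i.succAbove l)))
        else 0

/-- The Lie derivative `Lie_a = ι_a ∘ d - (-1)^|a| d ∘ ι_a`; the grade involution `involute` of the
exterior algebra multiplies an element of degree `k` by `(-1)^k`. -/
noncomputable def CELie (d : Module.End 𝕜 (CEModule A L)) :
    ExteriorAlgebra A L →ₗ[𝕜] Module.End 𝕜 (CEModule A L) where
  toFun a := CEContract 𝕜 A L a * d - d * CEContract 𝕜 A L (CliffordAlgebra.involute a)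
  map_add' a b := by
    simp only [map_add, add_mul, mul_add]
    abel
  map_smul' c a := by
    have h : CliffordAlgebra.involute (c • a) = c • CliffordAlgebra.involute a := by
      rw [← algebraMap_smul A c a, map_smul, algebraMap_smul]
    simp only [h, map_smul, smul_mul_assoc, mul_smul_comm, smul_sub, RingHom.id_apply]

variable (𝕜 A L) in
/-- Degree `n` of the Chevalley–Eilenberg complex: the dual of the `n`-th exterior power, that is,
the functionals vanishing on all other exterior powers. -/
def CEDegree (n : ℕ) : Submodule 𝕜 (CEModule A L) where
  carrier := {φ | ∀ m, m ≠ n → ∀ x ∈ ⋀[A]^m L, φ.toDual x = 0}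
  zero_mem' := fun _ _ _ _ => rfl
  add_mem' := by
    intro φ ψ hφ hψ m hm x hx
    change φ.toDual x + ψ.toDual x = 0
    rw [hφ m hm x hx, hψ m hm x hx, add_zero]
  smul_mem' := by
    intro c φ hφ m hm x hx
    change c • φ.toDual x = 0
    rw [hφ m hm x hx, smul_zero]

theorem CEDegree_isInternal : DirectSum.IsInternal (CEDegree 𝕜 A L) := by
  classical
  rw [DirectSum.isInternal_submodule_iff_iSupIndep_and_iSup_eq_top]
  have hvan : ∀ φ : CEModule A L, (∀ m, ∀ x ∈ ⋀[A]^m L, φ.toDual x = 0) → φ = 0 := by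
    intro φ h
    refine CEModule.ext fun x => ?_
    change φ.toDual x = 0
    rw [← DirectSum.sum_support_decompose (fun i : ℕ => ⋀[A]^i L) x, map_sum]
    exact Finset.sum_eq_zero fun i _ => h i _ (SetLike.coe_mem _)
  refine ⟨?_, ?_⟩
  · rw [iSupIndep_def]
    intro n
    rw [Submodule.disjoint_def]
    intro φ hφ hφ'
    apply hvan
    intro m x hx
    by_cases hm : m = n
    · subst hm
      let E : Submodule 𝕜 (CEModule A L) :=
        { carrier := {ψ | ψ.toDual x = 0}
          zero_mem' := rfl
          add_mem' := by
            intro a b ha hb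
            change a.toDual x + b.toDual x = 0
            rw [show a.toDual x = 0 from ha, show b.toDual x = 0 from hb, add_zero]
          smul_mem' := by
            intro c a ha
            change c • a.toDual x = 0
            rw [show a.toDual x = 0 from ha, smul_zero] }
      have hE : (⨆ j, ⨆ (_ : j ≠ m), CEDegree 𝕜 A L j) ≤ E :=
        iSup_le fun j => iSup_le fun hj ψ hψ => hψ m (Ne.symm hj) x hx
      exact hE hφ'
    · exact hφ m hm x hx
  · rw [eq_top_iff]
    rintro φ -
    obtain ⟨n, hn⟩ := φ.2
    have hproj : ∀ k m : ℕ, ∀ x ∈ ⋀[A]^m L,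
        GradedAlgebra.proj (fun i : ℕ => ⋀[A]^i L) k x = if m = k then x else 0 := by
      intro k m x hx
      rw [GradedAlgebra.proj_apply]
      split_ifs with h
      · subst h
        exact DirectSum.decompose_of_mem_same _ hx
      · exact DirectSum.decompose_of_mem_ne _ hx h
    let c : ℕ → CEModule A L := fun k =>
      ⟨φ.toDual ∘ₗ GradedAlgebra.proj (fun i : ℕ => ⋀[A]^i L) k, by
        refine ⟨k + 1, fun m hm x hx => ?_⟩
        rw [LinearMap.comp_apply, hproj k m x hx, if_neg (by omega), map_zero]⟩
    have hc : ∀ k, c k ∈ CEDegree 𝕜 A L k := by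
      intro k m hm x hx
      change φ.toDual (GradedAlgebra.proj (fun i : ℕ => ⋀[A]^i L) k x) = 0
      rw [hproj k m x hx, if_neg hm, map_zero]
    have hsum : φ = ∑ k ∈ Finset.range n, c k := by
      rw [← sub_eq_zero]
      apply hvan
      intro m x hx
      have h1 : (φ - ∑ k ∈ Finset.range n, c k).toDual x =
          φ.toDual x - ∑ k ∈ Finset.range n, (c k).toDual x := by
        simp [map_sub, map_sum, LinearMap.sub_apply, LinearMap.sum_apply]
      rw [h1]
      have h2 : ∀ k, (c k).toDual x = if m = k then φ.toDual x else 0 := by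
        intro k
        change φ.toDual (GradedAlgebra.proj (fun i : ℕ => ⋀[A]^i L) k x) = _
        rw [hproj k m x hx]
        split_ifs <;> simp
      simp only [h2, Finset.sum_ite_eq, Finset.mem_range]
      split_ifs with h
      · exact sub_self _
      · rw [sub_zero]
        exact hn m (by omega) x hx
    rw [hsum]
    exact Submodule.sum_mem _ fun k _ => Submodule.mem_iSup_of_mem k (hc k)

namespace ConstraintLieRinehart

/-- The functionals of degree `n` that are constraint morphisms from the constraint exterior algebra
to the constraint algebra `A`. -/
def CEW (CL : ConstraintLieRinehart CA L) (n : ℕ) : Submodule 𝕜 (CEModule A L) where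
  carrier := {φ | φ ∈ CEDegree 𝕜 A L n ∧ (∀ z ∈ CL.exteriorW n, φ.toDual z ∈ CA.W) ∧
    ∀ z ∈ CL.exteriorN n, φ.toDual z ∈ CA.N}
  zero_mem' := ⟨Submodule.zero_mem _, fun _ _ => CA.W.zero_mem, fun _ _ => CA.N.zero_mem⟩
  add_mem' := fun {_ _} h h' => ⟨Submodule.add_mem _ h.1 h'.1,
    fun z hz => CA.W.add_mem (h.2.1 z hz) (h'.2.1 z hz),
    fun z hz => CA.N.add_mem (h.2.2 z hz) (h'.2.2 z hz)⟩
  smul_mem' := fun c _ h => ⟨Submodule.smul_mem _ c h.1,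
    fun z hz => CA.W.smul_mem (h.2.1 z hz) c,
    fun z hz => CA.N.smul_mem c (h.2.2 z hz)⟩

/-- The functionals of degree `n` that map the `W`-component of the exterior algebra to `A_N`. -/
def CEN (CL : ConstraintLieRinehart CA L) (n : ℕ) : Submodule 𝕜 (CEModule A L) where
  carrier := {φ | φ ∈ CEDegree 𝕜 A L n ∧ ∀ z ∈ CL.exteriorW n, φ.toDual z ∈ CA.N}
  zero_mem' := ⟨Submodule.zero_mem _, fun _ _ => CA.N.zero_mem⟩
  add_mem' := fun {_ _} h h' => ⟨Submodule.add_mem _ h.1 h'.1,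
    fun z hz => CA.N.add_mem (h.2 z hz) (h'.2 z hz)⟩
  smul_mem' := fun c _ h => ⟨Submodule.smul_mem _ c h.1,
    fun z hz => CA.N.smul_mem c (h.2 z hz)⟩

/-- The Chevalley–Eilenberg complex as a constraint vector space: the constraint dual of the
constraint exterior algebra, with the grading reversed (so that it lives in degrees `≥ 0`). -/
def CE (CL : ConstraintLieRinehart CA L) : ConstraintGradedSpace 𝕜 (CEModule A L) where
  T := extendGrading (CEDegree 𝕜 A L)
  W := extendGrading CL.CEW
  N := extendGrading CL.CEN
  isInternal := extendGrading_isInternal CEDegree_isInternal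
  W_le_T := extendGrading_mono fun _ _ h => h.1
  N_le_W := extendGrading_mono fun n φ h => ⟨h.1, fun z hz => CA.N_le_W _ (h.2 z hz),
    fun z hz => h.2 z (Submodule.span_mono
      (by rintro _ ⟨f, hf, x, hx, -, rfl⟩; exact ⟨f, hf, x, hx, rfl⟩) hz)⟩

end ConstraintLieRinehart

end Exterior

/-! All the operators involved are forced by what they do with scalars and with left multiplication
by a vector, so each should be definable by recursion on multivectors and each identity provable by
induction on them. The obstacle is that none of the Lie derivative, the bracket and the differential
is `A`-linear: the anchor adds terms `x(f)`, and the universal property of the exterior algebra over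
`A` does not produce such maps.

`exists_recursion` removes the obstacle. A rule `F (x ∧ z) = q x (F z, z)` becomes an action of
scalars and vectors on pairs (value, multivector). If these operators satisfy the exterior
relations, `exists_ringHom` turns them into a ring homomorphism from the exterior algebra to
`𝕜`-linear endomorphisms, and `F z` is the first component of `z` acting on `(0, 1)`. The relations
to be checked are the Leibniz rules of a Lie–Rinehart algebra. This yields the Lie derivative `D_x`
of multivectors, then the bracket by recursion in its first argument, then `(dφ)(z)` by recursion in
`z`, with Cartan's formula `ι_x d = L_x - d ι_x` as the rule.

For the bracket, `{x, ·} = D_x` and `{f, ·}` is minus the contraction with `df`. Induction gives the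
Leibniz rule and antisymmetry. The Jacobi identity follows by induction on the last argument,
because `D_y` and contraction with `df` are both (graded) derivations of the bracket
(`lieDerivative_schouten`, `contractFun_schouten`).

For forms, `[L_x, d] = 0` is proved by induction on the argument, and Cartan's formula then shows
that `d²` commutes with every `ι_x`, so `d² = 0`. The one remaining substantial identity is `ι_{a,b}
= [L_a, ι_b]` (`CEContract_schouten`), by induction on `a`. Everything else in the calculus is
formal from it, from `L_a = [ι_a, d]` and from `d² = 0`.

The constraint statements need only that the recursion rules are built from products, brackets and
the anchor. Labelling `N` by `true` and `W` by `false`, every operation sends levels `p` and `q` to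
`p || q`. Unconstrained degree statements are the case where all components are everything. Since
most maps are only additive or `𝕜`-linear, signs, written as powers of `-1` in `A`, are moved
through them by `map_neg_one_pow_smul`. -/

theorem map_neg_one_pow_smul {R M N F : Type*} [Ring R] [AddCommGroup M] [Module R M]
    [AddCommGroup N] [Module R N] [FunLike F M N] [AddMonoidHomClass F M N] (φ : F) (n : ℕ)
    (a : M) :
    φ ((-1 : R) ^ n • a) = (-1 : R) ^ n • φ a := by
  obtain h | h := neg_one_pow_eq_or R n <;> simp [h]

/-! ### Recursion on the exterior algebra and sign rules -/

namespace ExteriorAlgebra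

open CliffordAlgebra (contractLeft involute)

section Recursion

variable {A L : Type*} [CommRing A] [AddCommGroup L] [Module A L]

/-- A ring homomorphism from the scalars together with an additive map from the module extend to the
exterior algebra under the evident relations, even when the scalars are not central in the
target. -/
theorem exists_ringHom {R : Type*} [Ring R] (α : A →+* R) (β : L →+ R)
    (hsmul : ∀ f x, β (f • x) = α f * β x) (hcomm : ∀ f x, β x * α f = α f * β x)
    (hsq : ∀ x, β x * β x = 0) :
    ∃ T : ExteriorAlgebra A L →+* R, (∀ f, T (algebraMap A _ f) = α f) ∧
      ∀ x, T (ι A x) = β x := by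
  -- Inside this centralizer the image of `α` is central, and it lies there itself because `A` is
  -- commutative. Hence `S` is an `A`-algebra although `R` need not be one, and the universal
  -- property applies to `S`.
  let S : Subring R := Subring.centralizer (Set.range α)
  have hα : ∀ f, α f ∈ S := by
    rintro f _ ⟨g, rfl⟩
    rw [← map_mul, ← map_mul, mul_comm]
  have hβ : ∀ x, β x ∈ S := by
    rintro x _ ⟨g, rfl⟩
    exact (hcomm g x).symm
  let α' : A →+* S := α.codRestrict S hα
  let _ : Algebra A S := α'.toAlgebra' fun c x => Subtype.ext (x.2 (α c) ⟨c, rfl⟩)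
  let β' : L →ₗ[A] S :=
    { toFun := fun x => ⟨β x, hβ x⟩
      map_add' := fun x y => Subtype.ext (map_add β x y)
      map_smul' := fun f x => Subtype.ext (hsmul f x) }
  let T := lift A ⟨β', fun x => Subtype.ext (hsq x)⟩
  refine ⟨S.subtype.comp T.toRingHom, fun f => ?_, fun x => ?_⟩
  · change ((T (algebraMap A _ f) : S) : R) = α f
    rw [T.commutes]
    rfl
  · change ((T (ι A x) : S) : R) = β x
    rw [lift_ι_apply]
    rfl

/-- Induction on the exterior algebra by left multiplication with vectors. -/
@[elab_as_elim]
theorem left_induction {P : ExteriorAlgebra A L → Prop} (algebraMap : ∀ f : A, P (algebraMap A _ f))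
    (add : ∀ a b, P a → P b → P (a + b)) (ι_mul : ∀ a x, P a → P (ι A x * a)) : ∀ a, P a :=
  CliffordAlgebra.left_induction (Q := (0 : QuadraticForm A L)) algebraMap add ι_mul

theorem ι_mul_mem {n : ℕ} (x : L) {a : ExteriorAlgebra A L} (ha : a ∈ ⋀[A]^n L) :
    ι A x * a ∈ ⋀[A]^(n + 1) L := by
  rw [exteriorPower, pow_succ']
  exact Submodule.mul_mem_mul ⟨x, rfl⟩ ha

/-- Induction on the homogeneous elements of the exterior algebra by left multiplication with
vectors. -/
@[elab_as_elim]
theorem homogeneous_induction {P : (n : ℕ) → (a : ExteriorAlgebra A L) → a ∈ ⋀[A]^n L → Prop}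
    (algebraMap : ∀ f : A, P 0 (algebraMap A _ f) (Submodule.algebraMap_mem f))
    (add : ∀ n a b ha hb, P n a ha → P n b hb → P n (a + b) (add_mem ha hb))
    (ι_mul : ∀ n a x ha, P n a ha → P (n + 1) (ι A x * a) (ι_mul_mem x ha))
    {n : ℕ} {a : ExteriorAlgebra A L} (ha : a ∈ ⋀[A]^n L) : P n a ha :=
  Submodule.pow_induction_on_left' (C := P) _ algebraMap
    (fun a b i => add i a b) (by rintro _ ⟨x, rfl⟩ i a hi h; exact ι_mul i a x hi h) ha

theorem involute_ι (x : L) : involute (ι A x) = -ι A x :=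
  CliffordAlgebra.involute_ι x

theorem contractLeft_ι_mul (δ : Module.Dual A L) (x : L) (a : ExteriorAlgebra A L) :
    (contractLeft δ (ι A x * a) : ExteriorAlgebra A L) = δ x • a - ι A x * contractLeft δ a :=
  CliffordAlgebra.contractLeft_ι_mul δ x a

variable {𝕜 N : Type*} [Field 𝕜] [Algebra 𝕜 A] [Module 𝕜 L] [IsScalarTower 𝕜 A L]
  [AddCommGroup N] [Module 𝕜 N]

/-- Recursion on the exterior algebra by left multiplication with scalars and vectors, which need
not be linear over the scalars. The submodule `S` is an invariant relation between the recursive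
value and the element of the exterior algebra. -/
theorem exists_recursion (S : Submodule 𝕜 (N × ExteriorAlgebra A L))
    (p : A → N × ExteriorAlgebra A L →ₗ[𝕜] N) (q : L → N × ExteriorAlgebra A L →ₗ[𝕜] N)
    (hS : (0, 1) ∈ S)
    (hpS : ∀ f, ∀ v ∈ S, (p f v, f • v.2) ∈ S) (hqS : ∀ x, ∀ v ∈ S, (q x v, ι A x * v.2) ∈ S)
    (p_add : ∀ f g, ∀ v ∈ S, p (f + g) v = p f v + p g v)
    (p_algebraMap : ∀ (c : 𝕜), ∀ v ∈ S, p (algebraMap 𝕜 A c) v = c • v.1)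
    (p_mul : ∀ f g, ∀ v ∈ S, p (f * g) v = p f (p g v, g • v.2))
    (q_add : ∀ x y, ∀ v ∈ S, q (x + y) v = q x v + q y v)
    (q_smul : ∀ f x, ∀ v ∈ S, q (f • x) v = p f (q x v, ι A x * v.2))
    (q_p : ∀ f x, ∀ v ∈ S, q x (p f v, f • v.2) = p f (q x v, ι A x * v.2))
    (q_q : ∀ x, ∀ v ∈ S, q x (q x v, ι A x * v.2) = 0) :
    ∃ F : ExteriorAlgebra A L →ₗ[𝕜] N, F 1 = 0 ∧ (∀ f z, F (f • z) = p f (F z, z)) ∧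
      (∀ x z, F (ι A x * z) = q x (F z, z)) ∧ ∀ z, (F z, z) ∈ S := by
  -- Carrying the multivector along as second component turns the inhomogeneous recursion into a
  -- linear action. The hypotheses on `p` and `q` are needed only on `S`, so they may use the
  -- invariant that `S` encodes.
  let P : A → S →ₗ[𝕜] S := fun f =>
    ((p f).prod ((Algebra.lsmul 𝕜 𝕜 (ExteriorAlgebra A L) f) ∘ₗ LinearMap.snd 𝕜 N _)).restrict
      (hpS f)
  let Q : L → S →ₗ[𝕜] S := fun x =>
    ((q x).prod ((LinearMap.mulLeft 𝕜 (ι A x)) ∘ₗ LinearMap.snd 𝕜 N _)).restrict (hqS x)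
  have hP : ∀ f v, (P f v : N × ExteriorAlgebra A L) = (p f v, f • v.1.2) := fun _ _ => rfl
  have hQ : ∀ x v, (Q x v : N × ExteriorAlgebra A L) = (q x v, ι A x * v.1.2) := fun _ _ => rfl
  have p_zero : ∀ v ∈ S, p 0 v = 0 := fun v hv => by simpa using p_algebraMap 0 v hv
  have p_one : ∀ v ∈ S, p 1 v = v.1 := fun v hv => by simpa using p_algebraMap 1 v hv
  let α : A →+* Module.End 𝕜 S :=
    { toFun := P
      map_zero' := LinearMap.ext fun v => Subtype.ext <| by
        rw [hP, p_zero v v.2, zero_smul]; rfl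
      map_one' := LinearMap.ext fun v => Subtype.ext <| by
        rw [hP, p_one v v.2, one_smul]; rfl
      map_add' := fun f g => LinearMap.ext fun v => Subtype.ext <| by
        rw [hP, p_add f g v v.2, add_smul]; rfl
      map_mul' := fun f g => LinearMap.ext fun v => Subtype.ext <| by
        rw [hP, p_mul f g v v.2, mul_smul]; rfl }
  let β : L →+ Module.End 𝕜 S := AddMonoidHom.mk' Q fun x y =>
    LinearMap.ext fun v => Subtype.ext <| by
      rw [hQ, q_add x y v v.2, map_add, add_mul]; rfl
  obtain ⟨T, hTα, hTβ⟩ := exists_ringHom (R := Module.End 𝕜 S) α β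
    (fun f x => LinearMap.ext fun v => Subtype.ext <| by
      change (q (f • x) v, ι A (f • x) * v.1.2) = (p f (q x v, ι A x * v.1.2), _)
      rw [q_smul f x v v.2, map_smul, smul_mul_assoc]; rfl)
    (fun f x => LinearMap.ext fun v => Subtype.ext <| by
      change (q x (p f v, f • v.1.2), ι A x * (f • v.1.2)) = (p f (q x v, ι A x * v.1.2), _)
      rw [q_p f x v v.2, mul_smul_comm]; rfl)
    (fun x => LinearMap.ext fun v => Subtype.ext <| by
      change (q x (q x v, ι A x * v.1.2), ι A x * (ι A x * v.1.2)) = 0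
      rw [q_q x v v.2, ← mul_assoc, ι_sq_zero, zero_mul]; rfl)
  let v₀ : S := ⟨(0, 1), hS⟩
  have hT_smul : ∀ f z v, (T (f • z) v : N × ExteriorAlgebra A L) = P f (T z v) := by
    intro f z v
    rw [Algebra.smul_def, map_mul, hTα]
    rfl
  have hT_mul : ∀ x z v, (T (ι A x * z) v : N × ExteriorAlgebra A L) = Q x (T z v) := by
    intro x z v
    rw [map_mul, hTβ]
    rfl
  -- Started at `(0, 1)`, the second component reproduces the multivector, so the value handed to
  -- `p` and `q` is paired with the right element.
  have hT_snd : ∀ z, (T z v₀ : N × ExteriorAlgebra A L).2 = z := by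
    intro z
    induction z using left_induction with
    | algebraMap f =>
      rw [hTα]
      change f • (1 : ExteriorAlgebra A L) = _
      rw [Algebra.algebraMap_eq_smul_one]
    | add z w hz hw =>
      rw [map_add, LinearMap.add_apply, Submodule.coe_add, Prod.snd_add, hz, hw]
    | ι_mul z x hz =>
      refine (congrArg Prod.snd (hT_mul x z v₀)).trans ?_
      rw [hQ, hz]
  have hT_pair : ∀ z, (T z v₀ : N × ExteriorAlgebra A L) =
      ((T z v₀ : N × ExteriorAlgebra A L).1, z) := fun z => Prod.ext rfl (hT_snd z)
  refine ⟨⟨⟨fun z => (T z v₀ : N × ExteriorAlgebra A L).1, fun z w => ?_⟩, fun c z => ?_⟩,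
    ?_, fun f z => ?_, fun x z => ?_, fun z => ?_⟩
  · rw [map_add]; rfl
  · change (T (c • z) v₀ : N × ExteriorAlgebra A L).1 = c • (T z v₀ : N × ExteriorAlgebra A L).1
    rw [← algebraMap_smul A c z, hT_smul, hP, p_algebraMap c _ (T z v₀).2]
  · change (T 1 v₀ : N × ExteriorAlgebra A L).1 = 0
    rw [map_one]; rfl
  · change (T (f • z) v₀ : N × ExteriorAlgebra A L).1 =
      p f ((T z v₀ : N × ExteriorAlgebra A L).1, z)
    rw [hT_smul, ← hT_pair]; rfl
  · change (T (ι A x * z) v₀ : N × ExteriorAlgebra A L).1 =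
      q x ((T z v₀ : N × ExteriorAlgebra A L).1, z)
    rw [hT_mul, ← hT_pair]; rfl
  · change ((T z v₀ : N × ExteriorAlgebra A L).1, z) ∈ S
    rw [← hT_pair]
    exact (T z v₀).2

theorem ι_mul_ι_mul_swap (x y : L) (z : ExteriorAlgebra A L) :
    ι A x * (ι A y * z) = -(ι A y * (ι A x * z)) := by
  rw [← mul_assoc, ← mul_assoc, eq_neg_iff_add_eq_zero, ← add_mul, ι_add_mul_swap, zero_mul]

theorem ι_mul_ι_mul_self (x : L) (z : ExteriorAlgebra A L) : ι A x * (ι A x * z) = 0 := by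
  rw [← mul_assoc, ι_sq_zero, zero_mul]

/-- With the grade involution in place of a sign, moving a vector past `a` needs no homogeneity. The
compatibility checks for the bracket recursion rely on this form. -/
theorem involute_mul_ι (a : ExteriorAlgebra A L) (x : L) :
    involute a * ι A x = ι A x * a := by
  induction a using left_induction with
  | algebraMap f => rw [AlgHom.commutes, Algebra.commutes]
  | add a b ha hb => rw [map_add, add_mul, ha, hb, mul_add]
  | ι_mul a y ha =>
    rw [map_mul, involute_ι, mul_assoc, ha]
    rw [ι_mul_ι_mul_swap x y, neg_mul]

/-- Elements of degree `n` super-commute with everything. -/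
theorem mul_eq_mul_iterate_involute {n : ℕ} {b : ExteriorAlgebra A L} (hb : b ∈ ⋀[A]^n L)
    (a : ExteriorAlgebra A L) : a * b = b * involute^[n] a := by
  induction hb using homogeneous_induction generalizing a with
  | algebraMap f => exact (Algebra.commutes f a).symm
  | add i b c _ _ hb hc => rw [mul_add, hb, hc, add_mul]
  | ι_mul i b x _ ih =>
    rw [Function.iterate_succ_apply, mul_assoc, ← ih, ← mul_assoc, ← mul_assoc,
      ← involute_mul_ι (involute a) x, CliffordAlgebra.involute_involute]

theorem involute_of_mem {n : ℕ} {a : ExteriorAlgebra A L} (ha : a ∈ ⋀[A]^n L) :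
    involute a = (-1 : A) ^ n • a := by
  induction ha using homogeneous_induction with
  | algebraMap f => rw [AlgHom.commutes, pow_zero, one_smul]
  | add i b c _ _ hb hc => rw [map_add, hb, hc, smul_add]
  | ι_mul i b x _ ih =>
    rw [map_mul, involute_ι, ih, pow_succ', mul_smul, neg_mul, mul_smul_comm,
      neg_smul, one_smul]

theorem iterate_involute_of_mem (k : ℕ) {n : ℕ} {a : ExteriorAlgebra A L} (ha : a ∈ ⋀[A]^n L) :
    involute^[k] a = (-1 : A) ^ (n * k) • a := by
  induction k with
  | zero => simp
  | succ k ih =>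
    rw [Function.iterate_succ_apply', ih, map_smul, involute_of_mem ha, smul_smul, ← pow_add,
      Nat.mul_succ]

theorem mul_comm_of_mem {m n : ℕ} {a b : ExteriorAlgebra A L} (ha : a ∈ ⋀[A]^m L)
    (hb : b ∈ ⋀[A]^n L) : a * b = (-1 : A) ^ (m * n) • (b * a) := by
  rw [mul_eq_mul_iterate_involute hb, iterate_involute_of_mem n ha, mul_smul_comm]

theorem algebraMap_mem_zero (f : A) : algebraMap A (ExteriorAlgebra A L) f ∈ ⋀[A]^0 L :=
  Submodule.algebraMap_mem f

theorem ι_mem_one (x : L) : ι A x ∈ ⋀[A]^1 L := by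
  simp

theorem involute_mem {n : ℕ} {a : ExteriorAlgebra A L} (ha : a ∈ ⋀[A]^n L) :
    involute a ∈ ⋀[A]^n L := by
  rw [involute_of_mem ha]
  exact Submodule.smul_mem _ _ ha

theorem ι_mul_of_mem {n : ℕ} (x : L) {b : ExteriorAlgebra A L} (hb : b ∈ ⋀[A]^n L) :
    ι A x * b = (-1 : A) ^ n • (b * ι A x) := by
  rw [← involute_mul_ι, involute_of_mem hb, smul_mul_assoc]

theorem involute_contractLeft (δ : Module.Dual A L) (a : ExteriorAlgebra A L) :
    involute (contractLeft δ a : ExteriorAlgebra A L) =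
      -(contractLeft δ (involute a) : ExteriorAlgebra A L) := by
  induction a using left_induction with
  | algebraMap f =>
    rw [AlgHom.commutes, CliffordAlgebra.contractLeft_algebraMap, map_zero, neg_zero]
  | add b c hb hc => rw [map_add, map_add, hb, hc, map_add, map_add, neg_add]
  | ι_mul a x ha =>
    rw [contractLeft_ι_mul, map_sub, map_smul, map_mul, map_mul, ha, involute_ι, neg_mul, neg_mul,
      map_neg, contractLeft_ι_mul, mul_neg, neg_neg, neg_neg]

theorem contractLeft_mul (δ : Module.Dual A L) (a b : ExteriorAlgebra A L) :
    (contractLeft δ (a * b) : ExteriorAlgebra A L) =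
      contractLeft δ a * b + involute a * contractLeft δ b := by
  induction a using left_induction with
  | algebraMap f =>
    rw [AlgHom.commutes, CliffordAlgebra.contractLeft_algebraMap,
      CliffordAlgebra.contractLeft_algebraMap_mul, zero_mul, zero_add]
  | add a c ha hc => rw [add_mul, map_add, ha, hc, map_add, map_add, add_mul, add_mul]; abel
  | ι_mul a x ha =>
    rw [mul_assoc, contractLeft_ι_mul, ha, contractLeft_ι_mul,
      map_mul, involute_ι, sub_mul, smul_mul_assoc, mul_add, neg_mul, neg_mul,
      ← mul_assoc, ← mul_assoc]
    abel

end Recursion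

end ExteriorAlgebra

/-! ### Contraction with the differential of a function -/

namespace LieRinehartAlgebra

open CliffordAlgebra (contractLeft involute)
open ExteriorAlgebra

section Anchor

variable {A L : Type*} [CommRing A] [LieRing L] [Module A L] [LieRingModule L A]
  [LieRinehartRing A L]

theorem lie_one (x : L) : ⁅x, (1 : A)⁆ = 0 := by
  have h := LieRinehartRing.leibniz_mul_right x (1 : A) 1
  rwa [mul_one, one_smul, mul_one, left_eq_add] at h

theorem lie_algebraMap (𝕜 : Type*) [Field 𝕜] [Algebra 𝕜 A] [LieAlgebra 𝕜 L]
    [LieRinehartAlgebra 𝕜 A L] (x : L) (c : 𝕜) : ⁅x, algebraMap 𝕜 A c⁆ = 0 := by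
  rw [Algebra.algebraMap_eq_smul_one]
  exact (lie_smul c x (1 : A)).trans (by rw [lie_one, smul_zero])

theorem smul_lie_eq (f : A) (x y : L) : ⁅f • x, y⁆ = f • ⁅x, y⁆ - ⁅y, f⁆ • x := by
  rw [← lie_skew, LieRinehartRing.leibniz_smul_right, ← lie_skew x y, smul_neg]
  abel

variable (L) in
/-- The differential `x ↦ x(f)` of a function `f`, as an `A`-linear form on `L`. -/
def anchorDual (f : A) : Module.Dual A L where
  toFun x := ⁅x, f⁆
  map_add' x y := add_lie x y f
  map_smul' a x := LieRinehartRing.lie_smul_eq_mul a f x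

@[simp]
theorem anchorDual_apply (f : A) (x : L) : anchorDual L f x = ⁅x, f⁆ := rfl

theorem anchorDual_add (f g : A) : anchorDual L (f + g) = anchorDual L f + anchorDual L g :=
  LinearMap.ext fun x => lie_add x f g

theorem anchorDual_mul (f g : A) :
    anchorDual L (f * g) = f • anchorDual L g + g • anchorDual L f :=
  LinearMap.ext fun x => by
    simp only [anchorDual_apply, LinearMap.add_apply, LinearMap.smul_apply, smul_eq_mul,
      LieRinehartRing.leibniz_mul_right, mul_comm]

theorem anchorDual_algebraMap (𝕜 : Type*) [Field 𝕜] [Algebra 𝕜 A] [LieAlgebra 𝕜 L]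
    [LieRinehartAlgebra 𝕜 A L] (c : 𝕜) : anchorDual L (algebraMap 𝕜 A c) = 0 :=
  LinearMap.ext fun x => lie_algebraMap 𝕜 x c

variable (L) in
/-- Contraction of multivectors with the differential of a function. -/
def contractFun (f : A) : ExteriorAlgebra A L →ₗ[A] ExteriorAlgebra A L :=
  contractLeft (anchorDual L f)

theorem contractFun_add (f g : A) : contractFun L (f + g) = contractFun L f + contractFun L g := by
  rw [contractFun, anchorDual_add, map_add]; rfl

theorem contractFun_mul (f g : A) :
    contractFun L (f * g) = f • contractFun L g + g • contractFun L f := by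
  rw [contractFun, anchorDual_mul, map_add, map_smul, map_smul]; rfl

theorem contractFun_coe (𝕜 : Type*) [Field 𝕜] [Algebra 𝕜 A] [LieAlgebra 𝕜 L]
    [LieRinehartAlgebra 𝕜 A L] (c : 𝕜) : contractFun L (algebraMap 𝕜 A c) = 0 := by
  rw [contractFun, anchorDual_algebraMap, map_zero]

theorem contractFun_algebraMap (f g : A) : contractFun L f (algebraMap A _ g) = 0 :=
  CliffordAlgebra.contractLeft_algebraMap _ _ _

theorem contractFun_one (f : A) : contractFun L f 1 = 0 :=
  CliffordAlgebra.contractLeft_one _ _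

theorem contractFun_ι_mul (f : A) (x : L) (a : ExteriorAlgebra A L) :
    contractFun L f (ι A x * a) = ⁅x, f⁆ • a - ι A x * contractFun L f a :=
  contractLeft_ι_mul _ x a

theorem contractFun_contractFun (f g : A) (a : ExteriorAlgebra A L) :
    contractFun L f (contractFun L g a) = -contractFun L g (contractFun L f a) :=
  CliffordAlgebra.contractLeft_comm _ _ _

theorem contractFun_mul_apply (f : A) (a b : ExteriorAlgebra A L) :
    contractFun L f (a * b) = contractFun L f a * b + involute a * contractFun L f b :=
  contractLeft_mul _ a b

theorem involute_contractFun (f : A) (a : ExteriorAlgebra A L) :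
    involute (contractFun L f a) = -contractFun L f (involute a) :=
  involute_contractLeft _ a

end Anchor

/-! ### The Lie derivative of multivectors -/

variable (𝕜 : Type*) {A L : Type*} [Field 𝕜] [CommRing A] [Algebra 𝕜 A] [LieRing L] [Module A L]
  [LieRingModule L A] [LieRinehartRing A L] [LieAlgebra 𝕜 L] [LieRinehartAlgebra 𝕜 A L]

/-- The invariant is trivial here (`S = ⊤`). The compatibilities amount to the anchor and `⁅x, ·⁆`
being derivations; in the square-zero condition the two terms containing `⁅x, y⁆` and `y` cancel by
anticommutation. -/
theorem exists_lieDerivative (x : L) :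
    ∃ D : ExteriorAlgebra A L →ₗ[𝕜] ExteriorAlgebra A L, D 1 = 0 ∧
      (∀ (f : A) z, D (f • z) = ⁅x, f⁆ • z + f • D z) ∧
      ∀ y z, D (ι A y * z) = ι A ⁅x, y⁆ * z + ι A y * D z := by
  obtain ⟨D, h1, hf, hx, -⟩ := exists_recursion (A := A) (L := L) (𝕜 := 𝕜)
    (N := ExteriorAlgebra A L) ⊤
    (fun f => (Algebra.lsmul 𝕜 𝕜 _ ⁅x, f⁆) ∘ₗ LinearMap.snd 𝕜 _ _ +
      (Algebra.lsmul 𝕜 𝕜 _ f) ∘ₗ LinearMap.fst 𝕜 _ _)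
    (fun y => (LinearMap.mulLeft 𝕜 (ι A ⁅x, y⁆)) ∘ₗ LinearMap.snd 𝕜 _ _ +
      (LinearMap.mulLeft 𝕜 (ι A y)) ∘ₗ LinearMap.fst 𝕜 _ _)
    trivial (fun _ _ _ => trivial) (fun _ _ _ => trivial)
    (by
      rintro f g ⟨w, z⟩ -
      change ⁅x, f + g⁆ • z + (f + g) • w = (⁅x, f⁆ • z + f • w) + (⁅x, g⁆ • z + g • w)
      rw [lie_add]; module)
    (by
      rintro c ⟨w, z⟩ -
      change ⁅x, algebraMap 𝕜 A c⁆ • z + algebraMap 𝕜 A c • w = c • w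
      rw [lie_algebraMap, zero_smul, zero_add, algebraMap_smul])
    (by
      rintro f g ⟨w, z⟩ -
      change ⁅x, f * g⁆ • z + (f * g) • w = ⁅x, f⁆ • g • z + f • (⁅x, g⁆ • z + g • w)
      rw [LieRinehartRing.leibniz_mul_right]; module)
    (by
      rintro y y' ⟨w, z⟩ -
      change ι A ⁅x, y + y'⁆ * z + ι A (y + y') * w =
        (ι A ⁅x, y⁆ * z + ι A y * w) + (ι A ⁅x, y'⁆ * z + ι A y' * w)
      rw [lie_add, map_add, map_add, add_mul, add_mul]; abel)
    (by
      rintro f y ⟨w, z⟩ -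
      change ι A ⁅x, f • y⁆ * z + ι A (f • y) * w =
        ⁅x, f⁆ • (ι A y * z) + f • (ι A ⁅x, y⁆ * z + ι A y * w)
      rw [LieRinehartRing.leibniz_smul_right, map_add, map_smul, map_smul, add_mul, smul_mul_assoc,
        smul_mul_assoc, map_smul, smul_mul_assoc]
      module)
    (by
      rintro f y ⟨w, z⟩ -
      change ι A ⁅x, y⁆ * (f • z) + ι A y * (⁅x, f⁆ • z + f • w) =
        ⁅x, f⁆ • (ι A y * z) + f • (ι A ⁅x, y⁆ * z + ι A y * w)
      rw [mul_add, mul_smul_comm, mul_smul_comm, mul_smul_comm]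
      module)
    (by
      rintro y ⟨w, z⟩ -
      change ι A ⁅x, y⁆ * (ι A y * z) + ι A y * (ι A ⁅x, y⁆ * z + ι A y * w) = 0
      rw [mul_add, ι_mul_ι_mul_self, add_zero, ι_mul_ι_mul_swap, neg_add_cancel])
  exact ⟨D, h1, hf, hx⟩

/-- The Lie derivative of multivectors along `x`: the derivation of the exterior algebra extending
the action of `x` on functions and on `L`. -/
noncomputable def lieDerivative (x : L) : ExteriorAlgebra A L →ₗ[𝕜] ExteriorAlgebra A L :=
  (exists_lieDerivative 𝕜 x).choose

theorem lieDerivative_one (x : L) : lieDerivative 𝕜 x (1 : ExteriorAlgebra A L) = 0 :=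
  (exists_lieDerivative 𝕜 x).choose_spec.1

theorem lieDerivative_smul (x : L) (f : A) (z : ExteriorAlgebra A L) :
    lieDerivative 𝕜 x (f • z) = ⁅x, f⁆ • z + f • lieDerivative 𝕜 x z :=
  (exists_lieDerivative 𝕜 x).choose_spec.2.1 f z

theorem lieDerivative_ι_mul (x y : L) (z : ExteriorAlgebra A L) :
    lieDerivative 𝕜 x (ι A y * z) = ι A ⁅x, y⁆ * z + ι A y * lieDerivative 𝕜 x z :=
  (exists_lieDerivative 𝕜 x).choose_spec.2.2 y z

theorem lieDerivative_algebraMap (x : L) (f : A) :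
    lieDerivative 𝕜 x (algebraMap A (ExteriorAlgebra A L) f) = algebraMap A _ ⁅x, f⁆ := by
  rw [Algebra.algebraMap_eq_smul_one, lieDerivative_smul, lieDerivative_one, smul_zero, add_zero,
    Algebra.algebraMap_eq_smul_one]

theorem lieDerivative_ι (x y : L) :
    lieDerivative 𝕜 x (ι A y) = ι A ⁅x, y⁆ := by
  rw [← mul_one (ι A y), lieDerivative_ι_mul, lieDerivative_one, mul_zero, add_zero, mul_one]

theorem lieDerivative_mul (x : L) (a b : ExteriorAlgebra A L) :
    lieDerivative 𝕜 x (a * b) = lieDerivative 𝕜 x a * b + a * lieDerivative 𝕜 x b := by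
  induction a using ExteriorAlgebra.left_induction with
  | algebraMap f =>
    rw [← Algebra.smul_def, lieDerivative_smul, lieDerivative_algebraMap, ← Algebra.smul_def,
      ← Algebra.smul_def]
  | add a c ha hc => rw [add_mul, map_add, ha, hc, map_add, add_mul, add_mul]; abel
  | ι_mul a y ha =>
    rw [mul_assoc, lieDerivative_ι_mul, ha, lieDerivative_ι_mul]
    noncomm_ring

theorem involute_lieDerivative (x : L) (a : ExteriorAlgebra A L) :
    involute (lieDerivative 𝕜 x a) = lieDerivative 𝕜 x (involute a) := by
  induction a using ExteriorAlgebra.left_induction with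
  | algebraMap f => rw [lieDerivative_algebraMap, AlgHom.commutes, AlgHom.commutes,
      lieDerivative_algebraMap]
  | add a c ha hc => rw [map_add, map_add, ha, hc, map_add, map_add]
  | ι_mul a y ha =>
    rw [lieDerivative_ι_mul, map_add, map_mul, map_mul, map_mul, ha, involute_ι, involute_ι,
      neg_mul, neg_mul, neg_mul, map_neg, lieDerivative_ι_mul, neg_add]

theorem lieDerivative_add (x y : L) (a : ExteriorAlgebra A L) :
    lieDerivative 𝕜 (x + y) a = lieDerivative 𝕜 x a + lieDerivative 𝕜 y a := by
  induction a using ExteriorAlgebra.left_induction with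
  | algebraMap f => simp only [lieDerivative_algebraMap, add_lie, map_add]
  | add a c ha hc => rw [map_add, ha, hc, map_add, map_add]; abel
  | ι_mul a z ha =>
    rw [lieDerivative_ι_mul, lieDerivative_ι_mul, lieDerivative_ι_mul, ha, add_lie, map_add]
    noncomm_ring

/-- The defect of `A`-linearity in `x` comes from `⁅f • x, y⁆ = f • ⁅x, y⁆ - ⁅y, f⁆ • x`. It is
exactly the term that makes the recursion for the bracket consistent under `f • x`. -/
theorem lieDerivative_smul_left (f : A) (x : L) (a : ExteriorAlgebra A L) :
    lieDerivative 𝕜 (f • x) a = f • lieDerivative 𝕜 x a - ι A x * contractFun L f a := by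
  induction a using ExteriorAlgebra.left_induction with
  | algebraMap g =>
    rw [lieDerivative_algebraMap, lieDerivative_algebraMap, contractFun_algebraMap, mul_zero,
      sub_zero, LieRinehartRing.lie_smul_eq_mul, map_mul, Algebra.smul_def]
  | add a c ha hc => rw [map_add, ha, hc, map_add, map_add, smul_add, mul_add]; abel
  | ι_mul a z ha =>
    rw [lieDerivative_ι_mul, lieDerivative_ι_mul, ha, smul_lie_eq, map_sub, map_smul, map_smul,
      contractFun_ι_mul, sub_mul, mul_sub, mul_sub, smul_mul_assoc, smul_mul_assoc, mul_smul_comm,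
      mul_smul_comm, ι_mul_ι_mul_swap x z]
    module

theorem lieDerivative_lie (x y : L) (a : ExteriorAlgebra A L) :
    lieDerivative 𝕜 ⁅x, y⁆ a =
      lieDerivative 𝕜 x (lieDerivative 𝕜 y a) - lieDerivative 𝕜 y (lieDerivative 𝕜 x a) := by
  induction a using ExteriorAlgebra.left_induction with
  | algebraMap g => simp only [lieDerivative_algebraMap, lie_lie, map_sub]
  | add a c ha hc => simp only [map_add, ha, hc]; abel
  | ι_mul a z ha =>
    simp only [lieDerivative_ι_mul, map_add, ha, lie_lie, map_sub]
    noncomm_ring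

theorem lieDerivative_contractFun (x : L) (f : A) (a : ExteriorAlgebra A L) :
    lieDerivative 𝕜 x (contractFun L f a) =
      contractFun L ⁅x, f⁆ a + contractFun L f (lieDerivative 𝕜 x a) := by
  induction a using ExteriorAlgebra.left_induction with
  | algebraMap g => simp only [lieDerivative_algebraMap, contractFun_algebraMap, map_zero, add_zero]
  | add a c ha hc => simp only [map_add, ha, hc]; abel
  | ι_mul a z ha =>
    simp only [lieDerivative_ι_mul, contractFun_ι_mul, map_add, map_sub, ha, lieDerivative_smul,
      lie_lie, sub_smul, mul_add]
    abel

/-! ### The Schouten–Nijenhuis bracket -/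

/-- Recursion in the first argument, with values in endomorphisms of the exterior algebra so that
the second argument stays free. The two rules are the Leibniz rule in the first argument for left
multiplication by a function and by a vector. -/
theorem exists_schouten :
    ∃ B : ExteriorAlgebra A L →ₗ[𝕜] ExteriorAlgebra A L →ₗ[𝕜] ExteriorAlgebra A L,
      B 1 = 0 ∧
      (∀ (f : A) a b, B (f • a) b = f • B a b - a * contractFun L f b) ∧
      ∀ x a b, B (ι A x * a) b = ι A x * B a b + involute a * lieDerivative 𝕜 x b := by
  let E := Module.End 𝕜 (ExteriorAlgebra A L)
  let μ : ExteriorAlgebra A L →ₗ[𝕜] E := (Algebra.lmul 𝕜 (ExteriorAlgebra A L)).toLinearMap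
  let σ : ExteriorAlgebra A L →ₗ[𝕜] ExteriorAlgebra A L :=
    (involute (Q := (0 : QuadraticForm A L))).toLinearMap.restrictScalars 𝕜
  obtain ⟨B, h1, hf, hx, -⟩ := exists_recursion (A := A) (L := L) (𝕜 := 𝕜) (N := E) ⊤
    (fun f => (LinearMap.mulLeft 𝕜 (Algebra.lsmul 𝕜 𝕜 _ f)) ∘ₗ LinearMap.fst 𝕜 E _ -
      (LinearMap.mulRight 𝕜 ((contractFun L f).restrictScalars 𝕜)) ∘ₗ μ ∘ₗ LinearMap.snd 𝕜 E _)
    (fun y => (LinearMap.mulLeft 𝕜 (μ (ι A y))) ∘ₗ LinearMap.fst 𝕜 E _ +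
      (LinearMap.mulRight 𝕜 (lieDerivative 𝕜 y)) ∘ₗ μ ∘ₗ σ ∘ₗ LinearMap.snd 𝕜 E _)
    trivial (fun _ _ _ => trivial) (fun _ _ _ => trivial)
    (by
      rintro f g ⟨φ, a⟩ -
      refine LinearMap.ext fun b => ?_
      change (f + g) • φ b - a * contractFun L (f + g) b =
        (f • φ b - a * contractFun L f b) + (g • φ b - a * contractFun L g b)
      rw [contractFun_add, LinearMap.add_apply, mul_add]; module)
    (by
      rintro c ⟨φ, a⟩ -
      refine LinearMap.ext fun b => ?_
      change algebraMap 𝕜 A c • φ b - a * contractFun L (algebraMap 𝕜 A c) b = c • φ b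
      rw [contractFun_coe, LinearMap.zero_apply, mul_zero, sub_zero, algebraMap_smul])
    (by
      rintro f g ⟨φ, a⟩ -
      refine LinearMap.ext fun b => ?_
      change (f * g) • φ b - a * contractFun L (f * g) b =
        f • (g • φ b - a * contractFun L g b) - (g • a) * contractFun L f b
      rw [contractFun_mul, LinearMap.add_apply, LinearMap.smul_apply, LinearMap.smul_apply,
        mul_add, mul_smul_comm, mul_smul_comm, smul_mul_assoc]
      module)
    (by
      rintro x y ⟨φ, a⟩ -
      refine LinearMap.ext fun b => ?_
      change ι A (x + y) * φ b + involute a * lieDerivative 𝕜 (x + y) b =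
        (ι A x * φ b + involute a * lieDerivative 𝕜 x b) +
          (ι A y * φ b + involute a * lieDerivative 𝕜 y b)
      rw [lieDerivative_add, map_add, mul_add, add_mul]; abel)
    (by
      rintro f x ⟨φ, a⟩ -
      refine LinearMap.ext fun b => ?_
      change ι A (f • x) * φ b + involute a * lieDerivative 𝕜 (f • x) b =
        f • (ι A x * φ b + involute a * lieDerivative 𝕜 x b) - (ι A x * a) * contractFun L f b
      rw [lieDerivative_smul_left, map_smul, smul_mul_assoc, mul_sub, ← mul_assoc, involute_mul_ι,
        mul_smul_comm]
      module)
    (by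
      rintro f x ⟨φ, a⟩ -
      refine LinearMap.ext fun b => ?_
      change ι A x * (f • φ b - a * contractFun L f b) + involute (f • a) * lieDerivative 𝕜 x b =
        f • (ι A x * φ b + involute a * lieDerivative 𝕜 x b) - (ι A x * a) * contractFun L f b
      rw [map_smul, smul_mul_assoc, mul_sub, mul_smul_comm, mul_assoc]
      module)
    (by
      rintro x ⟨φ, a⟩ -
      refine LinearMap.ext fun b => ?_
      change ι A x * (ι A x * φ b + involute a * lieDerivative 𝕜 x b) +
        involute (ι A x * a) * lieDerivative 𝕜 x b = 0
      rw [map_mul, involute_ι, mul_add, ι_mul_ι_mul_self, zero_add, mul_assoc, neg_mul,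
        add_neg_cancel])
  exact ⟨B, h1, fun f a b => LinearMap.congr_fun (hf f a) b,
    fun x a b => LinearMap.congr_fun (hx x a) b⟩

/-- The Schouten–Nijenhuis bracket of multivectors. -/
noncomputable def schouten :
    ExteriorAlgebra A L →ₗ[𝕜] ExteriorAlgebra A L →ₗ[𝕜] ExteriorAlgebra A L :=
  (exists_schouten 𝕜).choose

theorem schouten_algebraMap (f : A) (b : ExteriorAlgebra A L) :
    schouten 𝕜 (algebraMap A _ f) b = -contractFun L f b := by
  have h := (exists_schouten 𝕜 (A := A) (L := L)).choose_spec
  rw [Algebra.algebraMap_eq_smul_one]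
  refine (h.2.1 f 1 b).trans ?_
  rw [h.1, LinearMap.zero_apply, smul_zero, one_mul, zero_sub]

theorem schouten_ι_mul (x : L) (a b : ExteriorAlgebra A L) :
    schouten 𝕜 (ι A x * a) b = ι A x * schouten 𝕜 a b + involute a * lieDerivative 𝕜 x b :=
  (exists_schouten 𝕜 (A := A) (L := L)).choose_spec.2.2 x a b

theorem schouten_ι (x : L) (b : ExteriorAlgebra A L) :
    schouten 𝕜 (ι A x) b = lieDerivative 𝕜 x b := by
  have h := (exists_schouten 𝕜 (A := A) (L := L)).choose_spec.1
  rw [← mul_one (ι A x), schouten_ι_mul, schouten, h, LinearMap.zero_apply, mul_zero, zero_add,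
    map_one, one_mul]

/-- The construction treats the two arguments asymmetrically. This lemma and `schouten_apply_ι`
recover the values on generators in the second argument, from which antisymmetry is deduced. -/
theorem schouten_apply_algebraMap (a : ExteriorAlgebra A L) (f : A) :
    schouten 𝕜 a (algebraMap A _ f) = -contractFun L f (involute a) := by
  induction a using ExteriorAlgebra.left_induction with
  | algebraMap g => rw [schouten_algebraMap, AlgHom.commutes, contractFun_algebraMap,
      contractFun_algebraMap]
  | add a c ha hc => simp only [map_add, LinearMap.add_apply, ha, hc]; abel
  | ι_mul a x ha =>
    rw [schouten_ι_mul, ha, lieDerivative_algebraMap, map_mul, involute_ι, neg_mul, map_neg,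
      contractFun_ι_mul, ← Algebra.commutes, ← Algebra.smul_def]
    noncomm_ring

theorem schouten_apply_ι (a : ExteriorAlgebra A L) (y : L) :
    schouten 𝕜 a (ι A y) = -lieDerivative 𝕜 y a := by
  induction a using ExteriorAlgebra.left_induction with
  | algebraMap g =>
    rw [schouten_algebraMap, ← mul_one (ι A y), contractFun_ι_mul, contractFun_one,
      lieDerivative_algebraMap, mul_zero, sub_zero, Algebra.algebraMap_eq_smul_one]
  | add a c ha hc => simp only [map_add, LinearMap.add_apply, ha, hc]; abel
  | ι_mul a x ha =>
    rw [schouten_ι_mul, ha, lieDerivative_ι_mul, lieDerivative_ι, involute_mul_ι, ← lie_skew y x,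
      map_neg]
    noncomm_ring

theorem schouten_neg_one_pow_smul (n : ℕ) (a b : ExteriorAlgebra A L) :
    schouten 𝕜 ((-1 : A) ^ n • a) b = (-1 : A) ^ n • schouten 𝕜 a b :=
  map_neg_one_pow_smul ((schouten 𝕜).flip b) n a

/-- The Leibniz rule in the second argument. -/
theorem schouten_mul {n : ℕ} (a : ExteriorAlgebra A L) {b : ExteriorAlgebra A L}
    (hb : b ∈ ⋀[A]^n L) (c : ExteriorAlgebra A L) :
    schouten 𝕜 a (b * c) =
      schouten 𝕜 a b * c + (-1 : A) ^ n • (b * schouten 𝕜 (involute^[n] a) c) := by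
  induction a using ExteriorAlgebra.left_induction generalizing c with
  | algebraMap f =>
    have : involute^[n] (algebraMap A (ExteriorAlgebra A L) f) = algebraMap A _ f := by
      rw [iterate_involute_of_mem n (algebraMap_mem_zero f), zero_mul, pow_zero, one_smul]
    rw [this, schouten_algebraMap, schouten_algebraMap, schouten_algebraMap, contractFun_mul_apply,
      involute_of_mem hb, smul_mul_assoc, mul_neg, neg_mul, smul_neg, neg_add]
  | add a d ha hd =>
    have : involute^[n] (a + d) = involute^[n] a + involute^[n] d := iterate_map_add _ _ _ _
    simp only [this, map_add, LinearMap.add_apply, ha, hd, mul_add, add_mul, smul_add]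
    abel
  | ι_mul a x ha =>
    have hx : involute^[n] (ι A x * a) = (-1 : A) ^ n • (ι A x * involute^[n] a) := by
      have : involute^[n] (ι A x * a) = involute^[n] (ι A x) * involute^[n] a :=
        iterate_map_mul _ _ _ _
      rw [this, iterate_involute_of_mem n (ι_mem_one x), one_mul, smul_mul_assoc]
    -- Passing `b` costs `n` grade involutions of `a`, and these commute with the one already
    -- present; thus `a` need not be homogeneous.
    have hσ : involute a * b = b * involute (involute^[n] a) := by
      rw [mul_eq_mul_iterate_involute hb, ← Function.iterate_succ_apply,
        Function.iterate_succ_apply']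
    have hs : (-1 : A) ^ n * (-1) ^ n = 1 := by rw [← mul_pow]; simp
    have hxb : ι A x * b = (-1 : A) ^ n • (b * ι A x) := ι_mul_of_mem x hb
    rw [hx, schouten_neg_one_pow_smul, schouten_ι_mul, schouten_ι_mul, schouten_ι_mul,
      lieDerivative_mul, ha, mul_smul_comm, smul_smul, hs, one_smul, mul_add, mul_smul_comm,
      ← mul_assoc (ι A x) b, hxb, mul_add, ← mul_assoc (involute a) b, hσ, smul_mul_assoc,
      smul_smul, hs, one_smul, add_mul]
    noncomm_ring

theorem schouten_mul_of_mem {m n : ℕ} {a b : ExteriorAlgebra A L} (ha : a ∈ ⋀[A]^m L)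
    (hb : b ∈ ⋀[A]^n L) (c : ExteriorAlgebra A L) :
    schouten 𝕜 a (b * c) =
      schouten 𝕜 a b * c + (-1 : A) ^ ((m + 1) * n) • (b * schouten 𝕜 a c) := by
  rw [schouten_mul 𝕜 a hb, iterate_involute_of_mem n ha, schouten_neg_one_pow_smul, mul_smul_comm,
    smul_smul, ← pow_add, add_mul, one_mul, add_comm n]

theorem schouten_ι_mul_right {m : ℕ} {a : ExteriorAlgebra A L} (ha : a ∈ ⋀[A]^m L) (y : L)
    (b : ExteriorAlgebra A L) :
    schouten 𝕜 a (ι A y * b) =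
      -(lieDerivative 𝕜 y a * b) + (-1 : A) ^ (m + 1) • (ι A y * schouten 𝕜 a b) := by
  rw [schouten_mul_of_mem 𝕜 ha (ι_mem_one y), schouten_apply_ι, mul_one, neg_mul]

theorem lieDerivative_mem (x : L) {n : ℕ} {a : ExteriorAlgebra A L} (ha : a ∈ ⋀[A]^n L) :
    lieDerivative 𝕜 x a ∈ ⋀[A]^n L := by
  induction ha using homogeneous_induction with
  | algebraMap f => rw [lieDerivative_algebraMap]; exact algebraMap_mem_zero _
  | add n a b _ _ ha hb => rw [map_add]; exact add_mem ha hb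
  | ι_mul n a y ha ih =>
    rw [lieDerivative_ι_mul]
    exact add_mem (ι_mul_mem _ ha) (ι_mul_mem _ ih)

theorem schouten_antisymm {m n : ℕ} {a b : ExteriorAlgebra A L} (ha : a ∈ ⋀[A]^m L)
    (hb : b ∈ ⋀[A]^n L) :
    schouten 𝕜 a b = -((-1 : A) ^ ((m + 1) * (n + 1)) • schouten 𝕜 b a) := by
  induction hb using homogeneous_induction with
  | algebraMap f =>
    rw [schouten_apply_algebraMap, schouten_algebraMap, involute_of_mem ha, map_smul]
    rw [zero_add, mul_one, pow_succ]
    module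
  | add n b c _ _ hb hc =>
    rw [map_add, hb, hc, map_add, LinearMap.add_apply]
    module
  | ι_mul n b x hb ih =>
    rw [schouten_ι_mul_right 𝕜 ha, ih, schouten_ι_mul, mul_neg, mul_smul_comm, smul_add,
      mul_comm_of_mem (lieDerivative_mem 𝕜 x ha) hb, involute_of_mem hb, smul_mul_assoc]
    -- Only the parities of the degrees enter, so in each of the four cases all signs become
    -- explicit. The later sign comparisons of this kind work the same way.
    obtain h | h := Nat.even_or_odd m <;> obtain h' | h' := Nat.even_or_odd n <;>
      simp [pow_add, pow_mul, h.neg_one_pow, h'.neg_one_pow, add_mul, mul_add]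

/-- The Lie derivative is a derivation of the bracket. -/
theorem lieDerivative_schouten (x : L) (a b : ExteriorAlgebra A L) :
    lieDerivative 𝕜 x (schouten 𝕜 a b) =
      schouten 𝕜 (lieDerivative 𝕜 x a) b + schouten 𝕜 a (lieDerivative 𝕜 x b) := by
  induction a using ExteriorAlgebra.left_induction with
  | algebraMap f =>
    simp only [schouten_algebraMap, lieDerivative_algebraMap, map_neg, lieDerivative_contractFun]
    abel
  | add a c ha hc => simp only [map_add, LinearMap.add_apply, ha, hc]; abel
  | ι_mul a y ha =>
    simp only [schouten_ι_mul, map_add, LinearMap.add_apply, lieDerivative_mul, lieDerivative_ι, ha,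
      lieDerivative_lie, involute_lieDerivative]
    noncomm_ring

/-- Up to sign, contraction is the bracket with `f`, so this is the Jacobi identity with one
function among its arguments. It supplies the base case of `schouten_jacobi`. -/
theorem contractFun_schouten (f : A) (a b : ExteriorAlgebra A L) :
    contractFun L f (schouten 𝕜 a b) =
      schouten 𝕜 (contractFun L f a) b - schouten 𝕜 (involute a) (contractFun L f b) := by
  induction a using ExteriorAlgebra.left_induction with
  | algebraMap g =>
    rw [AlgHom.commutes, contractFun_algebraMap, schouten_algebraMap, schouten_algebraMap, map_neg,
      contractFun_contractFun, map_zero, LinearMap.zero_apply]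
    abel
  | add a c ha hc => simp only [map_add, LinearMap.add_apply, ha, hc]; abel
  | ι_mul a y ha =>
    have hsm : schouten 𝕜 (⁅y, f⁆ • a) b = ⁅y, f⁆ • schouten 𝕜 a b - a * contractFun L ⁅y, f⁆ b :=
      (exists_schouten 𝕜 (A := A) (L := L)).choose_spec.2.1 _ _ _
    rw [schouten_ι_mul, map_add, contractFun_ι_mul, ha, contractFun_mul_apply,
      CliffordAlgebra.involute_involute, contractFun_ι_mul, map_sub, LinearMap.sub_apply, hsm,
      schouten_ι_mul, map_mul, involute_ι, neg_mul, map_neg, LinearMap.neg_apply, schouten_ι_mul,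
      lieDerivative_contractFun, CliffordAlgebra.involute_involute, involute_contractFun]
    noncomm_ring

/-- The minus sign records that the bracket has odd degree `-1`. It gives the parity of a bracket
without the natural-number degree `m + n - 1`. -/
theorem involute_schouten (a b : ExteriorAlgebra A L) :
    involute (schouten 𝕜 a b) = -schouten 𝕜 (involute a) (involute b) := by
  induction a using ExteriorAlgebra.left_induction with
  | algebraMap g =>
    rw [AlgHom.commutes, schouten_algebraMap, schouten_algebraMap, map_neg, involute_contractFun]
  | add a c ha hc => simp only [map_add, LinearMap.add_apply, ha, hc]; abel
  | ι_mul a y ha =>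
    rw [schouten_ι_mul, map_add, map_mul, ha, map_mul, involute_lieDerivative, map_mul, involute_ι,
      neg_mul (ι A y) (involute a), map_neg, LinearMap.neg_apply, schouten_ι_mul]
    noncomm_ring

theorem contractFun_of_mem_zero (f : A) {a : ExteriorAlgebra A L} (ha : a ∈ ⋀[A]^0 L) :
    contractFun L f a = 0 := by
  rw [exteriorPower, pow_zero] at ha
  obtain ⟨g, rfl⟩ := Submodule.mem_one.mp ha
  exact contractFun_algebraMap f g

/-- Truncated subtraction is harmless, since contraction annihilates degree zero. -/
theorem contractFun_mem (f : A) {n : ℕ} {a : ExteriorAlgebra A L} (ha : a ∈ ⋀[A]^n L) :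
    contractFun L f a ∈ ⋀[A]^(n - 1) L := by
  induction ha using homogeneous_induction with
  | algebraMap g => rw [contractFun_algebraMap]; exact zero_mem _
  | add n a b _ _ ha hb => rw [map_add]; exact add_mem ha hb
  | ι_mul n a x ha ih =>
    rw [contractFun_ι_mul]
    refine sub_mem (Submodule.smul_mem _ _ ha) ?_
    obtain rfl | n := n
    · rw [contractFun_of_mem_zero f ha, mul_zero]
      exact zero_mem _
    · exact ι_mul_mem x ih

theorem schouten_jacobi {m n : ℕ} {a b : ExteriorAlgebra A L} (ha : a ∈ ⋀[A]^m L)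
    (hb : b ∈ ⋀[A]^n L) (c : ExteriorAlgebra A L) :
    schouten 𝕜 a (schouten 𝕜 b c) = schouten 𝕜 (schouten 𝕜 a b) c +
      (-1 : A) ^ ((m + 1) * (n + 1)) • schouten 𝕜 b (schouten 𝕜 a c) := by
  induction c using ExteriorAlgebra.left_induction with
  | algebraMap f =>
    have key : schouten 𝕜 (contractFun L f (involute a)) (involute b) =
        (-1 : A) ^ ((m + 1) * (n + 1)) • schouten 𝕜 b (contractFun L f (involute a)) := by
      -- For `m = 0` the contraction vanishes and the truncated degree is irrelevant. Otherwise
      -- antisymmetry applies in the true degree `m - 1`, and the involution of `b` contributes the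
      -- missing sign.
      obtain rfl | m := m
      · rw [contractFun_of_mem_zero f (involute_mem ha), map_zero, map_zero, LinearMap.zero_apply,
          smul_zero]
      · rw [schouten_antisymm 𝕜 (contractFun_mem f (involute_mem ha)) (involute_mem hb),
          involute_of_mem hb, schouten_neg_one_pow_smul]
        obtain h | h := Nat.even_or_odd m <;> obtain h' | h' := Nat.even_or_odd n <;>
          simp [pow_add, pow_mul, h.neg_one_pow, h'.neg_one_pow, add_mul, mul_add]
    simp only [schouten_apply_algebraMap, involute_schouten, map_neg, contractFun_schouten,
      CliffordAlgebra.involute_involute, key]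
    module
  | add c d hc hd => simp only [map_add, hc, hd]; module
  | ι_mul c y ih =>
    -- The sign is that of a first argument of degree `m + n - 1`; it is read off from the
    -- involution, which avoids subtracting.
    have hab : schouten 𝕜 (schouten 𝕜 a b) (ι A y * c) = -(lieDerivative 𝕜 y (schouten 𝕜 a b) * c) +
        (-1 : A) ^ (m + n) • (ι A y * schouten 𝕜 (schouten 𝕜 a b) c) := by
      rw [schouten_mul 𝕜 _ (ι_mem_one y), schouten_apply_ι, Function.iterate_one,
        involute_schouten, involute_of_mem ha, involute_of_mem hb, schouten_neg_one_pow_smul,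
        map_neg_one_pow_smul, smul_smul, ← pow_add, map_neg, LinearMap.neg_apply,
        schouten_neg_one_pow_smul, neg_mul, mul_neg, mul_smul_comm, pow_one]
      module
    rw [hab, schouten_ι_mul_right 𝕜 ha, schouten_ι_mul_right 𝕜 hb, map_add, map_neg,
      map_neg_one_pow_smul, map_add, map_neg, map_neg_one_pow_smul, schouten_ι_mul_right 𝕜 ha,
      schouten_ι_mul_right 𝕜 hb, schouten_mul_of_mem 𝕜 ha (lieDerivative_mem 𝕜 y hb),
      schouten_mul_of_mem 𝕜 hb (lieDerivative_mem 𝕜 y ha), ih, lieDerivative_schouten,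
      schouten_antisymm 𝕜 (lieDerivative_mem 𝕜 y ha) hb]
    obtain h | h := Nat.even_or_odd m <;> obtain h' | h' := Nat.even_or_odd n <;>
      simp [pow_add, pow_mul, h.neg_one_pow, h'.neg_one_pow, add_mul, mul_add] <;> abel

end LieRinehartAlgebra

/-! ### Products of vectors and extensionality -/

namespace ExteriorAlgebra

theorem comp_zero_succAbove {L : Type*} {m : ℕ} (x : Fin (m + 1) → L) :
    (fun l => x (Fin.succAbove 0 l)) = Matrix.vecTail x := by
  funext l
  simp [Matrix.vecTail]

variable {A L : Type*} [CommRing A] [AddCommGroup L] [Module A L]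

/-- Omitting any factor but the first leaves the first in front. Inductive steps for the explicit
formulas use this to match a sum over `x` with a sum over its tail. -/
theorem ιMulti_succ_succAbove {m : ℕ} (x : Fin (m + 2) → L) (i : Fin (m + 1)) :
    (ιMulti A (m + 1) fun l => x (i.succ.succAbove l)) =
      ι A (x 0) * ιMulti A m fun l => Matrix.vecTail x (i.succAbove l) := by
  rw [ιMulti_succ_apply]
  congr 2
  funext l
  simp [Matrix.vecTail]

theorem smul_ιMulti {m : ℕ} (f : A) (x : Fin (m + 1) → L) :
    f • ιMulti A (m + 1) x = ιMulti A (m + 1) (Function.update x 0 (f • x 0)) := by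
  rw [AlternatingMap.map_update_smul, Function.update_eq_self]

/-- Additive maps out of the exterior algebra are determined by their values on scalars and on
products of vectors. -/
theorem addHom_ext {N F : Type*} [AddCommGroup N] [FunLike F (ExteriorAlgebra A L) N]
    [AddMonoidHomClass F (ExteriorAlgebra A L) N] {φ ψ : F}
    (h₀ : ∀ f, φ (algebraMap A _ f) = ψ (algebraMap A _ f))
    (h₁ : ∀ m x, φ (ιMulti A (m + 1) x) = ψ (ιMulti A (m + 1) x)) : φ = ψ := by
  refine DFunLike.ext _ _ fun z => ?_
  have hz : z ∈ Submodule.span A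
      (Set.range fun x : Σ n, (Fin n → L) => ιMulti A (M := L) x.1 x.2) := by
    rw [ιMulti_span]
    trivial
  -- The maps are merely additive, so the span induction must carry an arbitrary coefficient. In
  -- positive degree `smul_ιMulti` absorbs it into the first vector.
  suffices ∀ f : A, φ (f • z) = ψ (f • z) by simpa using this 1
  induction hz using Submodule.span_induction with
  | mem z hz =>
    obtain ⟨⟨n, x⟩, rfl⟩ := hz
    intro f
    obtain rfl | n := n
    · simpa [Algebra.algebraMap_eq_smul_one] using h₀ f
    · change φ (f • ιMulti A (n + 1) x) = ψ (f • ιMulti A (n + 1) x)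
      rw [smul_ιMulti, h₁]
  | zero => simp
  | add a b _ _ ha hb => intro f; rw [smul_add, map_add, ha, hb, map_add]
  | smul g a _ ha => intro f; rw [smul_smul, ha]

end ExteriorAlgebra

/-! ### Explicit formulas and uniqueness of the bracket -/

namespace LieRinehartAlgebra

open CliffordAlgebra (contractLeft involute)
open ExteriorAlgebra

section

variable {A L : Type*} [CommRing A] [LieRing L] [Module A L] [LieRingModule L A]
  [LieRinehartRing A L]

theorem contractFun_ιMulti (f : A) (m : ℕ) (x : Fin (m + 1) → L) :
    contractFun L f (ιMulti A (m + 1) x) = ∑ i : Fin (m + 1), (-1 : ℤ) ^ (i : ℕ) •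
      (⁅x i, f⁆ • ιMulti A m fun l => x (i.succAbove l)) := by
  induction m with
  | zero =>
    rw [ιMulti_succ_apply, contractFun_ι_mul, ιMulti_zero_apply, contractFun_one]
    simp
  | succ m ih =>
    rw [ιMulti_succ_apply, contractFun_ι_mul, ih, Fin.sum_univ_succ (n := m + 1),
      comp_zero_succAbove,
      Finset.mul_sum, sub_eq_add_neg, ← Finset.sum_neg_distrib]
    congr 1
    · simp
    · refine Finset.sum_congr rfl fun i _ => ?_
      rw [ιMulti_succ_succAbove, mul_smul_comm, mul_smul_comm, Fin.val_succ, pow_succ, mul_neg_one,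
        neg_smul]
      rfl

end

variable (𝕜 : Type*) {A L : Type*} [Field 𝕜] [CommRing A] [Algebra 𝕜 A] [LieRing L] [Module A L]
  [LieRingModule L A] [LieRinehartRing A L] [LieAlgebra 𝕜 L] [LieRinehartAlgebra 𝕜 A L]

theorem lieDerivative_ιMulti (x : L) (n : ℕ) (y : Fin (n + 1) → L) :
    lieDerivative 𝕜 x (ιMulti A (n + 1) y) = ∑ j : Fin (n + 1), (-1 : ℤ) ^ (j : ℕ) •
      (ι A ⁅x, y j⁆ * ιMulti A n fun l => y (j.succAbove l)) := by
  induction n with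
  | zero => simp [lieDerivative_ι]
  | succ n ih =>
    rw [ιMulti_succ_apply, lieDerivative_ι_mul, ih, Fin.sum_univ_succ (n := n + 1),
      comp_zero_succAbove,
      Finset.mul_sum]
    congr 1
    · simp
    · refine Finset.sum_congr rfl fun i _ => ?_
      rw [ιMulti_succ_succAbove, mul_smul_comm, ι_mul_ι_mul_swap, Fin.val_succ, pow_succ,
        mul_neg_one, neg_smul, smul_neg]
      rfl

theorem schouten_ιMulti (m n : ℕ) (x : Fin (m + 1) → L) (y : Fin (n + 1) → L) :
    schouten 𝕜 (ιMulti A (m + 1) x) (ιMulti A (n + 1) y) =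
      ∑ i : Fin (m + 1), ∑ j : Fin (n + 1), (-1 : ℤ) ^ ((i : ℕ) + (j : ℕ)) •
        (ι A ⁅x i, y j⁆ * ιMulti A m (fun l => x (i.succAbove l)) *
          ιMulti A n (fun l => y (j.succAbove l))) := by
  induction m with
  | zero =>
    rw [ιMulti_succ_apply, ιMulti_zero_apply, mul_one, schouten_ι, lieDerivative_ιMulti]
    simp
  | succ m ih =>
    rw [ιMulti_succ_apply, schouten_ι_mul, ih, Fin.sum_univ_succ (n := m + 1), comp_zero_succAbove,
      Finset.mul_sum, lieDerivative_ιMulti, Finset.mul_sum]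
    -- The recursion puts the term omitting `x 0` last, while the sum over `i` puts it first.
    refine (add_comm _ _).trans (congrArg₂ _ ?_ ?_)
    · refine Finset.sum_congr rfl fun j _ => ?_
      rw [mul_smul_comm, ← mul_assoc, involute_mul_ι]
      simp
    · refine Finset.sum_congr rfl fun i _ => ?_
      rw [Finset.mul_sum]
      refine Finset.sum_congr rfl fun j _ => ?_
      rw [ιMulti_succ_succAbove, mul_smul_comm, mul_assoc, mul_assoc, mul_assoc, ι_mul_ι_mul_swap,
        Fin.val_succ, add_right_comm, pow_succ, mul_neg_one, neg_smul, smul_neg]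
      rfl

theorem isSchoutenNijenhuisBracket_schouten :
    IsSchoutenNijenhuisBracket (schouten 𝕜 (A := A) (L := L)) where
  apply_fun_fun f g := by rw [schouten_algebraMap, contractFun_algebraMap, neg_zero]
  apply_fun f m x := by rw [schouten_algebraMap, contractFun_ιMulti]
  apply_fun_right f m x := by
    rw [schouten_algebraMap, schouten_apply_algebraMap,
      involute_of_mem (ιMulti_range A (m + 1) ⟨x, rfl⟩), map_smul, smul_neg]
    obtain h | h := neg_one_pow_eq_or ℤ (m + 1)
    all_goals
      have h' := congrArg (Int.cast : ℤ → A) h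
      push_cast at h'
      rw [h, h']
      simp
  apply_mul := schouten_ιMulti 𝕜

variable {𝕜} in
theorem IsSchoutenNijenhuisBracket.unique
    {br br' : ExteriorAlgebra A L →ₗ[𝕜] ExteriorAlgebra A L →ₗ[𝕜] ExteriorAlgebra A L}
    (h : IsSchoutenNijenhuisBracket br) (h' : IsSchoutenNijenhuisBracket br') : br = br' := by
  refine addHom_ext (fun f => addHom_ext (fun g => ?_) fun n y => ?_)
    fun m x => addHom_ext (fun g => ?_) fun n y => ?_
  · rw [h.apply_fun_fun, h'.apply_fun_fun]
  · rw [h.apply_fun, h'.apply_fun]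
  · rw [h.apply_fun_right, h'.apply_fun_right, h.apply_fun, h'.apply_fun]
  · rw [h.apply_mul, h'.apply_mul]

end LieRinehartAlgebra

/-! ### Lie derivative of forms and construction of the differential -/

namespace LieRinehartAlgebra

open CliffordAlgebra (contractLeft involute)
open ExteriorAlgebra

section

variable {A L : Type*} [CommRing A] [LieRing L] [Module A L]

theorem toDual_CEInsert (x : L) (φ : CEModule A L) (z : ExteriorAlgebra A L) :
    (CEInsert x φ).toDual z = φ.toDual (ι A x * z) := rfl

theorem toDual_algebra_smul {𝕜 : Type*} [Field 𝕜] [Algebra 𝕜 A] (c : 𝕜) (φ : CEModule A L)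
    (z : ExteriorAlgebra A L) : (c • φ).toDual z = c • φ.toDual z := rfl

end

section

variable {A L : Type*} [CommRing A] [LieRing L] [Module A L] [LieRingModule L A]
  [LieRinehartRing A L]

/-- Multiplication with the differential of a function: it is dual to the contraction of
multivectors. -/
def wedgeFun (f : A) : CEModule A L →ₗ[A] CEModule A L where
  toFun φ := ⟨φ.toDual ∘ₗ contractFun L f, by
    obtain ⟨n, hn⟩ := φ.2
    refine ⟨n + 1, fun m hm x hx => ?_⟩
    exact hn _ (by omega) _ (contractFun_mem f hx)⟩
  map_add' _ _ := rfl
  map_smul' _ _ := rfl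

theorem toDual_wedgeFun (f : A) (φ : CEModule A L) (z : ExteriorAlgebra A L) :
    (wedgeFun f φ).toDual z = φ.toDual (contractFun L f z) := rfl

end

variable (𝕜 : Type*) {A L : Type*} [Field 𝕜] [CommRing A] [Algebra 𝕜 A] [LieRing L] [Module A L]
  [LieRingModule L A] [LieRinehartRing A L] [LieAlgebra 𝕜 L] [LieRinehartAlgebra 𝕜 A L]

/-- The Lie derivative of forms along an element of the Lie–Rinehart algebra. -/
noncomputable def lieForm (x : L) : Module.End 𝕜 (CEModule A L) where
  toFun φ := ⟨
    { toFun := fun z => ⁅x, φ.toDual z⁆ - φ.toDual (lieDerivative 𝕜 x z)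
      map_add' := fun z w => by simp only [map_add, lie_add]; abel
      map_smul' := fun f z => by
        simp only [map_smul, lieDerivative_smul, map_add, smul_eq_mul, RingHom.id_apply,
          LieRinehartRing.leibniz_mul_right]
        ring }, by
    obtain ⟨n, hn⟩ := φ.2
    refine ⟨n, fun m hm z hz => ?_⟩
    change ⁅x, φ.toDual z⁆ - φ.toDual (lieDerivative 𝕜 x z) = 0
    rw [show φ.toDual z = 0 from hn m hm z hz,
      show φ.toDual (lieDerivative 𝕜 x z) = 0 from hn m hm _ (lieDerivative_mem 𝕜 x hz), lie_zero,
      sub_zero]⟩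
  map_add' φ ψ := CEModule.ext fun z => by
    change ⁅x, φ.toDual z + ψ.toDual z⁆ - (φ.toDual _ + ψ.toDual _) =
      (⁅x, φ.toDual z⁆ - φ.toDual _) + (⁅x, ψ.toDual z⁆ - ψ.toDual _)
    rw [lie_add]
    abel
  map_smul' c φ := CEModule.ext fun z => by
    change ⁅x, c • φ.toDual z⁆ - c • φ.toDual _ = c • (⁅x, φ.toDual z⁆ - φ.toDual _)
    rw [smul_sub]
    congr 1
    exact lie_smul c x _

theorem toDual_lieForm (x : L) (φ : CEModule A L) (z : ExteriorAlgebra A L) :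
    (lieForm 𝕜 x φ).toDual z = ⁅x, φ.toDual z⁆ - φ.toDual (lieDerivative 𝕜 x z) := rfl

/-- Here `F z φ` plays the role of `(dφ)(z)`. The recursion runs over `z` for all `φ` at once,
because Cartan's formula replaces `φ` by its insertion. -/
theorem exists_differential_aux :
    ∃ F : ExteriorAlgebra A L →ₗ[𝕜] CEModule A L →ₗ[𝕜] A, F 1 = 0 ∧
      (∀ (f : A) z φ, F (f • z) φ = f * F z φ) ∧
      (∀ x z φ, F (ι A x * z) φ = (lieForm 𝕜 x φ).toDual z - F z (CEInsert x φ)) ∧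
      ∀ z (f : A) φ, F z (f • φ) = f * F z φ + φ.toDual (contractFun L f z) := by
  let E := CEModule A L →ₗ[𝕜] A
  -- The invariant is `d(fφ) = f dφ + df ∧ φ`, evaluated on the second component. It cannot be
  -- postponed: consistency under `f • x` involves the value at the form `f • ι_x φ`.
  let S : Submodule 𝕜 (E × ExteriorAlgebra A L) :=
    { carrier := {v | ∀ (f : A) φ, v.1 (f • φ) = f * v.1 φ + φ.toDual (contractFun L f v.2)}
      zero_mem' := fun f φ => by
        change (0 : A) = f * 0 + φ.toDual (contractFun L f 0)
        simp
      add_mem' := fun {v w} hv hw f φ => by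
        change v.1 (f • φ) + w.1 (f • φ) = f * (v.1 φ + w.1 φ) + φ.toDual (contractFun L f (v.2 +
          w.2))
        rw [hv, hw, map_add, map_add]
        ring
      smul_mem' := fun c v hv f φ => by
        change c • v.1 (f • φ) = f * (c • v.1 φ) + φ.toDual (contractFun L f (c • v.2))
        rw [hv, LinearMap.map_smul_of_tower, LinearMap.map_smul_of_tower, smul_add, mul_smul_comm] }
  let p : A → E × ExteriorAlgebra A L →ₗ[𝕜] E := fun f => LinearMap.mk₂ 𝕜 (fun v φ => f * v.1 φ)
    (fun v w φ => mul_add _ _ _) (fun c v φ => mul_smul_comm _ _ _)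
    (fun v φ ψ => by rw [map_add, mul_add]) (fun c v φ => by rw [map_smul, mul_smul_comm])
  let q : L → E × ExteriorAlgebra A L →ₗ[𝕜] E := fun x => LinearMap.mk₂ 𝕜
    (fun v φ => (lieForm 𝕜 x φ).toDual v.2 - v.1 (CEInsert x φ))
    (fun v w φ => by
      rw [Prod.snd_add, Prod.fst_add, map_add, LinearMap.add_apply]
      abel)
    (fun c v φ => by
      rw [Prod.smul_snd, Prod.smul_fst, LinearMap.map_smul_of_tower, LinearMap.smul_apply,
        smul_sub])
    (fun v φ ψ => by
      rw [map_add, map_add, map_add, map_add, LinearMap.add_apply]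
      abel)
    (fun c v φ => by
      rw [map_smul (lieForm 𝕜 x), toDual_algebra_smul, LinearMap.map_smul_of_tower (CEInsert x),
        map_smul v.1, smul_sub])
  have hp : ∀ f v φ, p f v φ = f * v.1 φ := fun _ _ _ => rfl
  have hq : ∀ x v φ, q x v φ = ⁅x, φ.toDual v.2⁆ - φ.toDual (lieDerivative 𝕜 x v.2) -
    v.1 (CEInsert x φ) := fun _ _ _ => rfl
  obtain ⟨F, h1, hf, hx, hF⟩ := exists_recursion S p q
    (by
      intro f φ
      change (0 : A) = f * 0 + _
      rw [contractFun_one, map_zero, mul_zero, add_zero])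
    (by
      intro g v hv f φ
      change g * v.1 (f • φ) = f * (g * v.1 φ) + φ.toDual (contractFun L f (g • v.2))
      rw [hv, map_smul, map_smul, smul_eq_mul]
      ring)
    (by
      intro x v hv f φ
      change q x v (f • φ) = f * q x v φ + φ.toDual (contractFun L f (ι A x * v.2))
      rw [hq, hq, map_smul, map_smul, hv, contractFun_ι_mul, LinearMap.smul_apply,
        LinearMap.smul_apply, smul_eq_mul, smul_eq_mul, LieRinehartRing.leibniz_mul_right, map_sub,
        map_smul, toDual_CEInsert, smul_eq_mul, smul_eq_mul]
      ring)
    (fun f g v _ => LinearMap.ext fun φ => add_mul _ _ _)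
    (fun c v _ => LinearMap.ext fun φ => (Algebra.smul_def _ _).symm)
    (fun f g v _ => LinearMap.ext fun φ => mul_assoc _ _ _)
    (fun x y v _ => LinearMap.ext fun φ => by
      rw [LinearMap.add_apply, hq, hq, hq, add_lie, lieDerivative_add, map_add, map_add,
        LinearMap.add_apply, map_add]
      abel)
    (fun f x v hv => LinearMap.ext fun φ => by
      rw [hp, hq]
      change _ = f * q x v φ
      rw [hq, lieDerivative_smul_left, LieRinehartRing.lie_smul_eq_mul, map_smul,
        LinearMap.smul_apply, hv, map_sub, map_smul, toDual_CEInsert, smul_eq_mul]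
      ring)
    (fun f x v _ => LinearMap.ext fun φ => by
      rw [hp, hq]
      change _ - f * v.1 (CEInsert x φ) = f * q x v φ
      rw [hq, lieDerivative_smul, map_add, map_smul, map_smul, map_smul, smul_eq_mul, smul_eq_mul,
        smul_eq_mul, LieRinehartRing.leibniz_mul_right, smul_eq_mul]
      ring)
    (fun x v _ => LinearMap.ext fun φ => by
      rw [hq]
      change _ - q x v (CEInsert x φ) = 0
      have : CEInsert x (CEInsert x φ) = 0 := LinearMap.congr_fun (CEInsert_mul_self x) φ
      rw [hq, this, map_zero, lieDerivative_ι_mul, lie_self, map_zero, zero_mul, zero_add,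
        toDual_CEInsert, toDual_CEInsert]
      abel)
  exact ⟨F, h1, fun f z φ => LinearMap.congr_fun (hf f z) φ,
    fun x z φ => LinearMap.congr_fun (hx x z) φ, hF⟩

theorem exists_differential :
    ∃ d : Module.End 𝕜 (CEModule A L), (∀ φ, (d φ).toDual 1 = 0) ∧
      (∀ x φ, CEInsert x (d φ) = lieForm 𝕜 x φ - d (CEInsert x φ)) ∧
      ∀ (f : A) φ, d (f • φ) = f • d φ + wedgeFun f φ := by
  obtain ⟨F, h1, hf, hx, hφ⟩ := exists_differential_aux 𝕜 (A := A) (L := L)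
  -- Without subtraction: if `φ` vanishes from degree `m - 1` on, then `dφ` vanishes in degree `m`.
  -- Hence `dφ` is again supported in finitely many degrees.
  have hvan : ∀ {m : ℕ} {z : ExteriorAlgebra A L}, z ∈ ⋀[A]^m L → ∀ φ : CEModule A L,
      (∀ k, m ≤ k + 1 → ∀ w ∈ ⋀[A]^k L, φ.toDual w = 0) → F z φ = 0 := by
    intro m z hz
    induction hz using homogeneous_induction with
    | algebraMap f =>
      intro φ _
      rw [Algebra.algebraMap_eq_smul_one, hf, h1, LinearMap.zero_apply, mul_zero]
    | add n a b _ _ ha hb =>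
      intro φ h
      rw [map_add, LinearMap.add_apply, ha φ h, hb φ h, add_zero]
    | ι_mul n a x ha ih =>
      intro φ h
      rw [hx, toDual_lieForm, h n le_rfl a ha, h n le_rfl _ (lieDerivative_mem 𝕜 x ha),
        ih _ fun k hk w hw => h (k + 1) (by omega) (ι A x * w) (ι_mul_mem x hw), lie_zero,
        sub_zero, sub_zero]
  refine ⟨⟨⟨fun φ => ⟨⟨⟨fun z => F z φ, fun z w => ?_⟩, fun f z => ?_⟩, ?_⟩, fun φ ψ => ?_⟩,
    fun c φ => ?_⟩, fun φ => ?_, fun x φ => ?_, fun f φ => ?_⟩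
  · rw [map_add, LinearMap.add_apply]
  · exact hf f z φ
  · obtain ⟨n, hn⟩ := φ.2
    exact ⟨n + 1, fun m hm z hz => hvan hz φ fun k hk w hw => hn k (by omega) w hw⟩
  · exact CEModule.ext fun z => map_add (F z) φ ψ
  · exact CEModule.ext fun z => map_smul (F z) c φ
  · exact LinearMap.congr_fun h1 φ
  · exact CEModule.ext fun z => hx x z φ
  · exact CEModule.ext fun z => hφ z f φ

variable (A L) in
/-- The Chevalley–Eilenberg differential. -/
noncomputable def differential : Module.End 𝕜 (CEModule A L) :=
  (exists_differential 𝕜).choose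

theorem toDual_differential_one (φ : CEModule A L) : (differential 𝕜 A L φ).toDual 1 = 0 :=
  (exists_differential 𝕜).choose_spec.1 φ

/-- Cartan's formula for the insertion of a vector. -/
theorem CEInsert_differential (x : L) (φ : CEModule A L) :
    CEInsert x (differential 𝕜 A L φ) = lieForm 𝕜 x φ - differential 𝕜 A L (CEInsert x φ) :=
  (exists_differential 𝕜).choose_spec.2.1 x φ

theorem differential_smul (f : A) (φ : CEModule A L) :
    differential 𝕜 A L (f • φ) = f • differential 𝕜 A L φ + wedgeFun f φ :=
  (exists_differential 𝕜).choose_spec.2.2 f φ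

theorem toDual_differential_ι_mul (x : L) (φ : CEModule A L) (z : ExteriorAlgebra A L) :
    (differential 𝕜 A L φ).toDual (ι A x * z) = ⁅x, φ.toDual z⁆ - φ.toDual (lieDerivative 𝕜 x z) -
      (differential 𝕜 A L (CEInsert x φ)).toDual z :=
  congrArg (fun ψ => CEModule.toDual ψ z) (CEInsert_differential 𝕜 x φ)

end LieRinehartAlgebra

/-! ### The Chevalley–Eilenberg formula -/

namespace LieRinehartAlgebra

open CliffordAlgebra (contractLeft involute)
open ExteriorAlgebra

variable (𝕜 : Type*) {A L : Type*} [Field 𝕜] [CommRing A] [Algebra 𝕜 A] [LieRing L] [Module A L]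
  [LieRingModule L A] [LieRinehartRing A L] [LieAlgebra 𝕜 L] [LieRinehartAlgebra 𝕜 A L]

theorem toDual_differential_ι (φ : CEModule A L) (x : L) :
    (differential 𝕜 A L φ).toDual (ι A x) = ⁅x, φ.toDual 1⁆ := by
  rw [← mul_one (ι A x), toDual_differential_ι_mul, lieDerivative_one, map_zero, sub_zero,
    toDual_differential_one, sub_zero]

theorem toDual_differential_ιMulti (φ : CEModule A L) (n : ℕ) (x : Fin (n + 2) → L) :
    (differential 𝕜 A L φ).toDual (ιMulti A (n + 2) x) =
      (∑ i : Fin (n + 2), (-1 : ℤ) ^ (i : ℕ) •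
        ⁅x i, φ.toDual (ιMulti A (n + 1) fun l => x (i.succAbove l))⁆) +
      ∑ i : Fin (n + 1), ∑ j : Fin (n + 2), if i.castSucc < j then
        (-1 : ℤ) ^ ((i : ℕ) + (j : ℕ)) •
          φ.toDual (ι A ⁅x i.castSucc, x j⁆ *
            ιMulti A n fun l => x (j.succAbove (i.succAbove l)))
        else 0 := by
  induction n generalizing φ with
  | zero =>
    rw [ιMulti_succ_apply, ιMulti_succ_apply, ιMulti_zero_apply, mul_one,
      toDual_differential_ι_mul, toDual_differential_ι, lieDerivative_ι, toDual_CEInsert]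
    simp [Fin.sum_univ_succ, Matrix.vecTail]
    abel
  | succ n ih =>
    rw [ιMulti_succ_apply, toDual_differential_ι_mul, ih, lieDerivative_ιMulti,
      Fin.sum_univ_succ (n := n + 2), Fin.sum_univ_succ (n := n + 1)
        (f := fun i => ∑ j : Fin (n + 3), _)]
    -- The Lie derivative along `x 0` supplies the bracket terms whose smaller index is `0`. The
    -- other terms come from `d(ι_{x 0} φ)`: in `h₂` and `h₄` one index shifts, which gives the
    -- sign; in `h₃` both shift, and the sign comes from moving `x 0` past the bracket.
    have h₁ : φ.toDual (∑ j : Fin (n + 2), (-1 : ℤ) ^ (j : ℕ) • (ι A ⁅x 0, Matrix.vecTail x j⁆ *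
        ιMulti A (n + 1) fun l => Matrix.vecTail x (j.succAbove l))) =
        -∑ j : Fin (n + 3), if (0 : Fin (n + 2)).castSucc < j then
          (-1 : ℤ) ^ (((0 : Fin (n + 2)) : ℕ) + (j : ℕ)) •
            φ.toDual (ι A ⁅x (0 : Fin (n + 2)).castSucc, x j⁆ *
              ιMulti A (n + 1) fun l => x (j.succAbove ((0 : Fin (n + 2)).succAbove l)))
          else 0 := by
      rw [Fin.sum_univ_succ (n := n + 2), map_sum, if_neg (by simp), zero_add,
        ← Finset.sum_neg_distrib]
      refine Finset.sum_congr rfl fun j _ => ?_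
      rw [if_pos (by simp [Fin.lt_def]), map_zsmul, Fin.val_zero, zero_add, Fin.val_succ, pow_succ,
        mul_neg_one, neg_smul, neg_neg]
      congr 4
      funext l
      simp [Matrix.vecTail]
    have h₂ : ∀ i : Fin (n + 2), ⁅Matrix.vecTail x i, (CEInsert (x 0) φ).toDual
        (ιMulti A (n + 1) fun l => Matrix.vecTail x (i.succAbove l))⁆ =
        ⁅x i.succ, φ.toDual (ιMulti A (n + 2) fun l => x (i.succ.succAbove l))⁆ := by
      intro i
      rw [ιMulti_succ_succAbove, toDual_CEInsert]
      rfl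
    have h₃ : ∀ i : Fin (n + 1), (∑ j : Fin (n + 3), if i.succ.castSucc < j then
          (-1 : ℤ) ^ ((i.succ : ℕ) + (j : ℕ)) •
            φ.toDual (ι A ⁅x i.succ.castSucc, x j⁆ *
              ιMulti A (n + 1) fun l => x (j.succAbove (i.succ.succAbove l)))
          else 0) = -∑ j : Fin (n + 2), if i.castSucc < j then
        (-1 : ℤ) ^ ((i : ℕ) + (j : ℕ)) •
          (CEInsert (x 0) φ).toDual (ι A ⁅Matrix.vecTail x i.castSucc, Matrix.vecTail x j⁆ *
            ιMulti A n fun l => Matrix.vecTail x (j.succAbove (i.succAbove l)))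
        else 0 := by
      intro i
      rw [Fin.sum_univ_succ (n := n + 2), if_neg (by simp), zero_add, ← Finset.sum_neg_distrib]
      refine Finset.sum_congr rfl fun j _ => ?_
      have hx : (ιMulti A (n + 1) fun l => x (j.succ.succAbove (i.succ.succAbove l))) =
          ι A (x 0) * ιMulti A n fun l => Matrix.vecTail x (j.succAbove (i.succAbove l)) := by
        rw [ιMulti_succ_apply]
        congr 2
        funext l
        simp [Matrix.vecTail]
      simp only [Fin.castSucc_succ, Fin.succ_lt_succ_iff]
      split_ifs
      · rw [hx, toDual_CEInsert, ι_mul_ι_mul_swap, Fin.val_succ, Fin.val_succ, map_neg,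
          show (i : ℕ) + 1 + (j + 1) = i + j + 2 by ring, pow_add, neg_one_sq, mul_one, smul_neg]
        rfl
      · rw [neg_zero]
    have h₄ : ∀ i : Fin (n + 2), (-1 : ℤ) ^ (i.succ : ℕ) •
        ⁅x i.succ, φ.toDual (ιMulti A (n + 2) fun l => x (i.succ.succAbove l))⁆ =
        -((-1 : ℤ) ^ (i : ℕ) •
          ⁅x i.succ, φ.toDual (ιMulti A (n + 2) fun l => x (i.succ.succAbove l))⁆) := by
      intro i
      rw [Fin.val_succ, pow_succ, mul_neg_one, neg_smul]
    simp only [h₁, h₂, h₃, h₄, Finset.sum_neg_distrib, comp_zero_succAbove, Fin.val_zero, pow_zero,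
      one_smul]
    abel

theorem isCEDifferential_differential : IsCEDifferential (differential 𝕜 A L) where
  apply_one := toDual_differential_one 𝕜
  apply_one_vector := toDual_differential_ι 𝕜
  apply_vectors := toDual_differential_ιMulti 𝕜

variable {𝕜} in
theorem IsCEDifferential.unique {d d' : Module.End 𝕜 (CEModule A L)} (h : IsCEDifferential d)
    (h' : IsCEDifferential d') : d = d' := by
  refine LinearMap.ext fun φ => CEModule.ext fun z => ?_
  refine DFunLike.congr_fun (addHom_ext (fun f => ?_) fun m x => ?_) z
  · rw [Algebra.algebraMap_eq_smul_one, map_smul, map_smul, h.apply_one, h'.apply_one]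
  · obtain rfl | m := m
    · rw [ιMulti_succ_apply, ιMulti_zero_apply, mul_one, h.apply_one_vector, h'.apply_one_vector]
    · rw [h.apply_vectors, h'.apply_vectors]

/-! ### The Cartan calculus -/

theorem lieForm_CEInsert (x y : L) (φ : CEModule A L) :
    lieForm 𝕜 x (CEInsert y φ) = CEInsert ⁅x, y⁆ φ + CEInsert y (lieForm 𝕜 x φ) :=
  CEModule.ext fun z => by
    rw [map_add, LinearMap.add_apply]
    simp only [toDual_lieForm, toDual_CEInsert, lieDerivative_ι_mul, map_add]
    abel

theorem lieForm_lie (x y : L) (φ : CEModule A L) :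
    lieForm 𝕜 ⁅x, y⁆ φ = lieForm 𝕜 x (lieForm 𝕜 y φ) - lieForm 𝕜 y (lieForm 𝕜 x φ) :=
  CEModule.ext fun z => by
    rw [map_sub, LinearMap.sub_apply]
    simp only [toDual_lieForm, lieDerivative_lie, map_sub, lie_lie, lie_sub]
    abel

theorem lieForm_smul (x : L) (f : A) (φ : CEModule A L) :
    lieForm 𝕜 x (f • φ) = ⁅x, f⁆ • φ + f • lieForm 𝕜 x φ :=
  CEModule.ext fun z => by
    rw [map_add, LinearMap.add_apply]
    simp only [toDual_lieForm, map_smul, LinearMap.smul_apply, smul_eq_mul,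
      LieRinehartRing.leibniz_mul_right]
    ring

/-- The commutator of `L_x` and `d` anticommutes with every insertion and vanishes on `1`. Induction
on the argument, for all `φ` simultaneously, therefore annihilates it. -/
theorem lieForm_differential (x : L) (φ : CEModule A L) :
    lieForm 𝕜 x (differential 𝕜 A L φ) = differential 𝕜 A L (lieForm 𝕜 x φ) := by
  refine CEModule.ext fun z => ?_
  induction z using ExteriorAlgebra.left_induction generalizing φ with
  | algebraMap f =>
    rw [Algebra.algebraMap_eq_smul_one, map_smul, map_smul, toDual_lieForm,
      toDual_differential_one, toDual_differential_one, lieDerivative_one, map_zero, lie_zero,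
      sub_zero]
  | add a b ha hb => rw [map_add, ha, hb, map_add]
  | ι_mul a y ih =>
    -- After Cartan's formula is applied for `y` and for `⁅x, y⁆`, the terms with two Lie
    -- derivatives cancel because `L_{[x,y]} = [L_x, L_y]`.
    have h : CEInsert y (lieForm 𝕜 x (differential 𝕜 A L φ)) -
        CEInsert y (differential 𝕜 A L (lieForm 𝕜 x φ)) =
        -(lieForm 𝕜 x (differential 𝕜 A L (CEInsert y φ)) -
          differential 𝕜 A L (lieForm 𝕜 x (CEInsert y φ))) := by
      have h₁ := lieForm_CEInsert 𝕜 x y (differential 𝕜 A L φ)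
      have h₂ := lieForm_CEInsert 𝕜 x y φ
      rw [← sub_eq_iff_eq_add'] at h₁ h₂
      rw [← h₁, CEInsert_differential, CEInsert_differential, CEInsert_differential, ← h₂,
        lieForm_lie, map_sub, map_sub]
      abel
    have h' := congrArg (fun ψ => CEModule.toDual ψ a) h
    simp only [map_sub, map_neg, LinearMap.sub_apply, LinearMap.neg_apply, ih, sub_self,
      neg_zero] at h'
    exact sub_eq_zero.mp h'

/-- Cartan's formula twice, together with `[L_x, d] = 0`, gives `ι_x d² = d² ι_x`; the induction
ends at `(dψ)(1) = 0`. -/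
theorem differential_differential (φ : CEModule A L) :
    differential 𝕜 A L (differential 𝕜 A L φ) = 0 := by
  refine CEModule.ext fun z => ?_
  rw [map_zero, LinearMap.zero_apply]
  induction z using ExteriorAlgebra.left_induction generalizing φ with
  | algebraMap f =>
    rw [Algebra.algebraMap_eq_smul_one, map_smul, toDual_differential_one, smul_zero]
  | add a b ha hb => rw [map_add, ha, hb, add_zero]
  | ι_mul a x ih =>
    rw [← toDual_CEInsert, CEInsert_differential, CEInsert_differential,
      map_sub (differential 𝕜 A L),
      lieForm_differential, sub_sub_cancel, ih]

theorem CEInsert_wedgeFun (f : A) (x : L) (φ : CEModule A L) :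
    CEInsert x (wedgeFun f φ) = ⁅x, f⁆ • φ - wedgeFun f (CEInsert x φ) :=
  CEModule.ext fun z => by
    rw [map_sub, LinearMap.sub_apply, map_smul, LinearMap.smul_apply]
    simp only [toDual_wedgeFun, toDual_CEInsert, contractFun_ι_mul, map_sub, map_smul]

theorem CEContract_mul (a b : ExteriorAlgebra A L) :
    CEContract 𝕜 A L (a * b) = CEContract 𝕜 A L a * CEContract 𝕜 A L b :=
  LinearMap.ext fun φ => LinearMap.congr_fun (map_mul CEContractHom a b) φ

theorem CEContract_one : CEContract 𝕜 A L 1 = 1 :=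
  LinearMap.ext fun φ => LinearMap.congr_fun (map_one CEContractHom) φ

theorem CEContract_smul (f : A) (a : ExteriorAlgebra A L) (φ : CEModule A L) :
    CEContract 𝕜 A L (f • a) φ = f • CEContract 𝕜 A L a φ :=
  LinearMap.congr_fun (map_smul CEContractHom f a) φ

theorem CEContract_algebraMap (f : A) (φ : CEModule A L) :
    CEContract 𝕜 A L (algebraMap A _ f) φ = f • φ := by
  rw [Algebra.algebraMap_eq_smul_one, CEContract_smul, CEContract_one, Module.End.one_apply]

theorem CEContract_ι (x : L) (φ : CEModule A L) :
    CEContract 𝕜 A L (ι A x) φ = CEInsert x φ :=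
  LinearMap.congr_fun (lift_ι_apply A CEInsert CEInsert_mul_self x) φ

theorem CEContract_ι_mul (x : L) (a : ExteriorAlgebra A L) (φ : CEModule A L) :
    CEContract 𝕜 A L (ι A x * a) φ = CEInsert x (CEContract 𝕜 A L a φ) := by
  rw [CEContract_mul, Module.End.mul_apply, CEContract_ι]

theorem CEContract_comm {m n : ℕ} {a b : ExteriorAlgebra A L} (ha : a ∈ ⋀[A]^m L)
    (hb : b ∈ ⋀[A]^n L) (φ : CEModule A L) :
    CEContract 𝕜 A L a (CEContract 𝕜 A L b φ) =
      (-1 : A) ^ (m * n) • CEContract 𝕜 A L b (CEContract 𝕜 A L a φ) := by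
  rw [← Module.End.mul_apply, ← CEContract_mul, mul_comm_of_mem ha hb, CEContract_smul,
    CEContract_mul, Module.End.mul_apply]

theorem lieForm_CEContract (x : L) (b : ExteriorAlgebra A L) (φ : CEModule A L) :
    lieForm 𝕜 x (CEContract 𝕜 A L b φ) =
      CEContract 𝕜 A L (lieDerivative 𝕜 x b) φ + CEContract 𝕜 A L b (lieForm 𝕜 x φ) := by
  induction b using ExteriorAlgebra.left_induction with
  | algebraMap f =>
    rw [lieDerivative_algebraMap, CEContract_algebraMap, CEContract_algebraMap,
      CEContract_algebraMap, lieForm_smul]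
  | add a b ha hb => simp only [map_add, LinearMap.add_apply, ha, hb]; abel
  | ι_mul a y ih =>
    rw [CEContract_ι_mul, lieForm_CEInsert, ih, lieDerivative_ι_mul, map_add, map_add,
      LinearMap.add_apply, CEContract_ι_mul, CEContract_ι_mul, CEContract_ι_mul]
    abel

/-- Since `L_f` is minus multiplication by `df`, this is `ι_{f,b} = [L_f, ι_b]`, the base case of
`CEContract_schouten`. -/
theorem wedgeFun_CEContract (f : A) (b : ExteriorAlgebra A L) (φ : CEModule A L) :
    wedgeFun f (CEContract 𝕜 A L b φ) =
      CEContract 𝕜 A L (contractFun L f b) φ + CEContract 𝕜 A L (involute b) (wedgeFun f φ) := by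
  induction b using ExteriorAlgebra.left_induction with
  | algebraMap g =>
    rw [contractFun_algebraMap, AlgHom.commutes, CEContract_algebraMap, CEContract_algebraMap,
      map_smul, map_zero, LinearMap.zero_apply, zero_add]
  | add a b ha hb => simp only [map_add, LinearMap.add_apply, ha, hb]; abel
  | ι_mul a y ih =>
    have h := CEInsert_wedgeFun f y (CEContract 𝕜 A L a φ)
    rw [eq_sub_iff_add_eq, ← eq_sub_iff_add_eq'] at h
    rw [CEContract_ι_mul, h, ih, contractFun_ι_mul, map_sub, LinearMap.sub_apply, CEContract_smul,
      CEContract_ι_mul, map_mul, involute_ι, neg_mul, map_neg, LinearMap.neg_apply,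
      CEContract_ι_mul, map_add]
    abel

theorem CELie_apply (d : Module.End 𝕜 (CEModule A L)) (a : ExteriorAlgebra A L)
    (φ : CEModule A L) :
    CELie d a φ = CEContract 𝕜 A L a (d φ) - d (CEContract 𝕜 A L (involute a) φ) := rfl

theorem CELie_apply_of_mem (d : Module.End 𝕜 (CEModule A L)) {m : ℕ} {a : ExteriorAlgebra A L}
    (ha : a ∈ ⋀[A]^m L) (φ : CEModule A L) :
    CELie d a φ = CEContract 𝕜 A L a (d φ) - (-1 : A) ^ m • d (CEContract 𝕜 A L a φ) := by
  rw [CELie_apply, involute_of_mem ha, CEContract_smul, map_neg_one_pow_smul]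

theorem CELie_algebraMap (f : A) (φ : CEModule A L) :
    CELie (differential 𝕜 A L) (algebraMap A _ f) φ = -wedgeFun f φ := by
  rw [CELie_apply, AlgHom.commutes, CEContract_algebraMap, CEContract_algebraMap,
    differential_smul]
  abel

theorem CELie_ι_mul {m : ℕ} (x : L) {a : ExteriorAlgebra A L} (ha : a ∈ ⋀[A]^m L)
    (φ : CEModule A L) :
    CELie (differential 𝕜 A L) (ι A x * a) φ =
      CEInsert x (CELie (differential 𝕜 A L) a φ) +
        (-1 : A) ^ m • lieForm 𝕜 x (CEContract 𝕜 A L a φ) := by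
  have h := CEInsert_differential 𝕜 x (CEContract 𝕜 A L a φ)
  rw [eq_sub_iff_add_eq] at h
  rw [CELie_apply_of_mem 𝕜 _ (ι_mul_mem x ha), CELie_apply_of_mem 𝕜 _ ha, ← h, CEContract_ι_mul,
    CEContract_ι_mul, map_sub, map_smul, pow_succ]
  module

/-- In the inductive step both `{x ∧ a, b}` and `L_{x ∧ a}` split into an `x`-insertion and a Lie
derivative along `x`. The two sides agree because `[L_x, ι_b] = ι_{D_x b}`. -/
theorem CEContract_schouten {m n : ℕ} {a b : ExteriorAlgebra A L} (ha : a ∈ ⋀[A]^m L)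
    (hb : b ∈ ⋀[A]^n L) (φ : CEModule A L) :
    CEContract 𝕜 A L (schouten 𝕜 a b) φ =
      CELie (differential 𝕜 A L) a (CEContract 𝕜 A L b φ) -
        (-1 : A) ^ ((m + 1) * n) •
          CEContract 𝕜 A L b (CELie (differential 𝕜 A L) a φ) := by
  induction ha using homogeneous_induction with
  | algebraMap f =>
    rw [CELie_algebraMap, CELie_algebraMap, wedgeFun_CEContract, schouten_algebraMap,
      involute_of_mem hb, CEContract_smul, map_neg, map_neg, LinearMap.neg_apply, zero_add, one_mul]
    module
  | add m a c _ _ ha hc =>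
    simp only [map_add, LinearMap.add_apply, ha, hc]
    module
  | ι_mul m a x ha ih =>
    have h₁ : CEContract 𝕜 A L b (CEInsert x (CELie (differential 𝕜 A L) a φ)) =
        (-1 : A) ^ n • CEInsert x (CEContract 𝕜 A L b (CELie (differential 𝕜 A L) a φ)) := by
      rw [← CEContract_ι 𝕜, CEContract_comm 𝕜 hb (ι_mem_one x), mul_one, CEContract_ι]
    rw [schouten_ι_mul, map_add, LinearMap.add_apply, CEContract_ι_mul, ih, CELie_ι_mul 𝕜 x ha,
      CELie_ι_mul 𝕜 x ha, map_add, h₁, map_neg_one_pow_smul, lieForm_CEContract,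
      lieForm_CEContract, lieForm_CEContract, map_add, map_add, involute_of_mem ha, smul_mul_assoc,
      CEContract_smul, CEContract_mul, Module.End.mul_apply,
      CEContract_comm 𝕜 hb (lieDerivative_mem 𝕜 x ha), CEContract_comm 𝕜 hb ha, map_sub, map_smul]
    obtain h | h := Nat.even_or_odd m <;> obtain h' | h' := Nat.even_or_odd n <;>
      simp [pow_add, pow_mul, h.neg_one_pow, h'.neg_one_pow, add_mul] <;> abel

theorem CELie_differential {m : ℕ} {a : ExteriorAlgebra A L} (ha : a ∈ ⋀[A]^m L)
    (φ : CEModule A L) :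
    CELie (differential 𝕜 A L) a (differential 𝕜 A L φ) =
      (-1 : A) ^ (m + 1) • differential 𝕜 A L (CELie (differential 𝕜 A L) a φ) := by
  rw [CELie_apply_of_mem 𝕜 _ ha, CELie_apply_of_mem 𝕜 _ ha, differential_differential, map_zero,
    map_sub, map_neg_one_pow_smul, differential_differential, pow_succ]
  module

/-- Formal: `L_{a,b}` is the commutator of `ι_{a,b} = [L_a, ι_b]` with `d`, and `L_a` supercommutes
with `d` because `d² = 0`. -/
theorem CELie_schouten {m n : ℕ} {a b : ExteriorAlgebra A L} (ha : a ∈ ⋀[A]^m L)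
    (hb : b ∈ ⋀[A]^n L) (φ : CEModule A L) :
    CELie (differential 𝕜 A L) (schouten 𝕜 a b) φ =
      CELie (differential 𝕜 A L) a (CELie (differential 𝕜 A L) b φ) -
        (-1 : A) ^ ((m + 1) * (n + 1)) •
          CELie (differential 𝕜 A L) b (CELie (differential 𝕜 A L) a φ) := by
  -- The exponent `m + n + 1` has the parity of the true degree `m + n - 1`.
  have h : involute (schouten 𝕜 a b) = (-1 : A) ^ (m + n + 1) • schouten 𝕜 a b := by
    rw [involute_schouten, involute_of_mem ha, involute_of_mem hb, schouten_neg_one_pow_smul,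
      map_neg_one_pow_smul]
    module
  rw [CELie_apply, h, CEContract_smul, map_neg_one_pow_smul, CEContract_schouten 𝕜 ha hb,
    CEContract_schouten 𝕜 ha hb, CELie_apply_of_mem 𝕜 _ hb, CELie_apply_of_mem 𝕜 _ hb, map_sub,
    map_sub, map_neg_one_pow_smul, map_neg_one_pow_smul, CELie_differential 𝕜 ha,
    CELie_differential 𝕜 ha, map_neg_one_pow_smul]
  obtain h | h := Nat.even_or_odd m <;> obtain h' | h' := Nat.even_or_odd n <;>
    simp [pow_add, pow_mul, h.neg_one_pow, h'.neg_one_pow, add_mul, mul_add] <;> abel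

theorem CELie_mul {m n : ℕ} {a b : ExteriorAlgebra A L} (ha : a ∈ ⋀[A]^m L)
    (hb : b ∈ ⋀[A]^n L) (φ : CEModule A L) :
    CELie (differential 𝕜 A L) (a * b) φ =
      CEContract 𝕜 A L a (CELie (differential 𝕜 A L) b φ) +
        (-1 : A) ^ n • CELie (differential 𝕜 A L) a (CEContract 𝕜 A L b φ) := by
  rw [CELie_apply, map_mul involute, involute_of_mem ha, involute_of_mem hb, smul_mul_assoc,
    mul_smul_comm,
    CEContract_smul, CEContract_smul, map_neg_one_pow_smul, map_neg_one_pow_smul,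
    CELie_apply_of_mem 𝕜 _ ha, CELie_apply_of_mem 𝕜 _ hb, CEContract_mul, Module.End.mul_apply,
    Module.End.mul_apply, map_sub, map_neg_one_pow_smul]
  module

/-- Writing `L_a` and `L_b` through `d` gives the same four terms as `CEContract_schouten`, once the
contractions by `a` and `b` are interchanged. -/
theorem CEContract_schouten' {m n : ℕ} {a b : ExteriorAlgebra A L} (ha : a ∈ ⋀[A]^m L)
    (hb : b ∈ ⋀[A]^n L) (φ : CEModule A L) :
    CEContract 𝕜 A L (schouten 𝕜 a b) φ =
      (-1 : A) ^ (n + 1) • (CEContract 𝕜 A L a (CELie (differential 𝕜 A L) b φ) -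
        (-1 : A) ^ (m * (n + 1)) •
          CELie (differential 𝕜 A L) b (CEContract 𝕜 A L a φ)) := by
  rw [CEContract_schouten 𝕜 ha hb, CELie_apply_of_mem 𝕜 _ hb, CELie_apply_of_mem 𝕜 _ hb,
    CELie_apply_of_mem 𝕜 _ ha, CELie_apply_of_mem 𝕜 _ ha, map_sub, map_sub, map_neg_one_pow_smul,
    map_neg_one_pow_smul, CEContract_comm 𝕜 hb ha, CEContract_comm 𝕜 hb ha, map_neg_one_pow_smul]
  obtain h | h := Nat.even_or_odd m <;> obtain h' | h' := Nat.even_or_odd n <;>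
    simp [pow_add, pow_mul, h.neg_one_pow, h'.neg_one_pow, add_mul, mul_add] <;> abel

end LieRinehartAlgebra

open CliffordAlgebra (contractLeft involute)
open ExteriorAlgebra LieRinehartAlgebra

/-! ### Membership in gradings extended to the integers -/

section ExtendGrading

variable {𝕜 V : Type*} [Field 𝕜] [AddCommGroup V] [Module 𝕜 V]

theorem mem_extendGrading_iff {F : ℕ → Submodule 𝕜 V} {i : ℤ} {v : V} :
    v ∈ extendGrading F i ↔ v = 0 ∨ ∃ n : ℕ, i = n ∧ v ∈ F n := by
  cases i with
  | ofNat n =>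
    refine ⟨fun h => Or.inr ⟨n, rfl, h⟩, ?_⟩
    rintro (rfl | ⟨m, hm, h⟩)
    · exact zero_mem _
    · obtain rfl : n = m := by simpa using hm
      exact h
  | negSucc n =>
    refine ⟨fun h => Or.inl ((Submodule.mem_bot 𝕜).mp h), ?_⟩
    rintro (rfl | ⟨m, hm, h⟩)
    · exact zero_mem _
    · exact absurd hm (by simp [Int.negSucc_eq]; omega)

theorem mem_extendGrading_of_mem {F : ℕ → Submodule 𝕜 V} {n : ℕ} {v : V} (h : v ∈ F n) {i : ℤ}
    (hi : i = n) : v ∈ extendGrading F i :=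
  mem_extendGrading_iff.mpr (Or.inr ⟨n, hi, h⟩)

end ExtendGrading

/-! ### Constraint components as a Boolean level -/

namespace ConstraintAlgebra

variable {𝕜 A : Type*} [Field 𝕜] [CommRing A] [Algebra 𝕜 A] (CA : ConstraintAlgebra 𝕜 A)

/-- The `N`-component (for `true`) and the `W`-component (for `false`). -/
def level : Bool → Submodule 𝕜 A
  | true => CA.N
  | false => Subalgebra.toSubmodule CA.W

variable {CA}

theorem mem_W_of_mem_level {p : Bool} {a : A} (ha : a ∈ CA.level p) : a ∈ CA.W :=
  match p, ha with
  | true, ha => CA.N_le_W a ha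
  | false, ha => ha

/-- Since `true` is absorbing for `||`, one statement covers `W·W ⊆ W`, `N·W ⊆ N` and `W·N ⊆ N`.
Stating all estimates this way allows one induction to prove the three versions together. -/
theorem mul_mem_level {p q : Bool} {a b : A} (ha : a ∈ CA.level p) (hb : b ∈ CA.level q) :
    a * b ∈ CA.level (p || q) :=
  match p, q, ha, hb with
  | false, false, ha, hb => CA.W.mul_mem ha hb
  | false, true, ha, hb => CA.mul_mem_N a ha b hb
  | true, _, ha, hb => mul_comm a b ▸ CA.mul_mem_N b (mem_W_of_mem_level hb) a ha

variable (𝕜 A) in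
/-- The constraint structure all of whose components are `A`. -/
def trivial : ConstraintAlgebra 𝕜 A where
  W := ⊤
  N := ⊤
  N_le_W _ _ := Algebra.mem_top
  mul_mem_N _ _ _ _ := Submodule.mem_top

end ConstraintAlgebra

namespace ConstraintLieRinehart

variable {𝕜 A : Type*} [Field 𝕜] [CommRing A] [Algebra 𝕜 A] {CA : ConstraintAlgebra 𝕜 A}
  {L : Type*} [LieRing L] [Module A L] [LieRingModule L A]
  [LieRinehartRing A L] [LieAlgebra 𝕜 L] [LieRinehartAlgebra 𝕜 A L]

variable (𝕜 A L) in
/-- The constraint structure all of whose components are `L`. -/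
def trivial : ConstraintLieRinehart (ConstraintAlgebra.trivial 𝕜 A) L where
  W := ⊤
  N := ⊤
  N_le_W := le_rfl
  smul_mem_W _ _ _ _ := Submodule.mem_top
  smul_mem_N_left _ _ _ _ := Submodule.mem_top
  smul_mem_N_right _ _ _ _ := Submodule.mem_top
  lie_mem_W _ _ _ _ := Submodule.mem_top
  lie_mem_N _ _ _ _ := Submodule.mem_top
  anchor_W_mem_W _ _ _ _ := Algebra.mem_top
  anchor_W_mem_N _ _ _ _ := Submodule.mem_top
  anchor_N_mem_N _ _ _ _ := Submodule.mem_top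

variable (CL : ConstraintLieRinehart CA L)

/-- The `N`-component (for `true`) and the `W`-component (for `false`). -/
def level : Bool → Submodule 𝕜 L
  | true => CL.N
  | false => CL.W

/-- The `N`-component (for `true`) and the `W`-component (for `false`) of the exterior algebra. -/
def extLevel : Bool → ℕ → Submodule 𝕜 (ExteriorAlgebra A L)
  | true => CL.exteriorN
  | false => CL.exteriorW

/-- The components `extLevel`, indexed by integers. -/
def extLevelInt (p : Bool) : ℤ → Submodule 𝕜 (ExteriorAlgebra A L) :=
  extendGrading (CL.extLevel p)

variable {CL}

theorem mem_W_of_mem_level {p : Bool} {x : L} (hx : x ∈ CL.level p) : x ∈ CL.W :=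
  match p, hx with
  | true, hx => CL.N_le_W hx
  | false, hx => hx

theorem lie_mem_level {p q : Bool} {x y : L} (hx : x ∈ CL.level p) (hy : y ∈ CL.level q) :
    ⁅x, y⁆ ∈ CL.level (p || q) :=
  match p, q, hx, hy with
  | false, false, hx, hy => CL.lie_mem_W x hx y hy
  | false, true, hx, hy => CL.lie_mem_N x hx y hy
  | true, _, hx, hy => by
    rw [← lie_skew]
    exact neg_mem (CL.lie_mem_N y (mem_W_of_mem_level hy) x hx)

theorem anchor_mem_level {p q : Bool} {x : L} {a : A} (hx : x ∈ CL.level p) (ha : a ∈ CA.level q) :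
    ⁅x, a⁆ ∈ CA.level (p || q) :=
  match p, q, hx, ha with
  | false, false, hx, ha => CL.anchor_W_mem_W x hx a ha
  | false, true, hx, ha => CL.anchor_W_mem_N x hx a ha
  | true, _, hx, ha => CL.anchor_N_mem_N x hx a (ConstraintAlgebra.mem_W_of_mem_level ha)

theorem extLevel_true_le (n : ℕ) : CL.extLevel true n ≤ CL.extLevel false n :=
  Submodule.span_mono fun _ ⟨f, hf, x, hx, _, h⟩ => ⟨f, hf, x, hx, h⟩

theorem algebraMap_mem_extLevel {p : Bool} {f : A} (hf : f ∈ CA.level p) :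
    algebraMap A _ f ∈ CL.extLevel p 0 := by
  have h : algebraMap A (ExteriorAlgebra A L) f = f • ιMulti A 0 (0 : Fin 0 → L) := by
    rw [ιMulti_zero_apply, Algebra.algebraMap_eq_smul_one]
  match p, hf with
  | true, hf =>
    exact Submodule.subset_span ⟨f, CA.N_le_W f hf, 0, fun i => i.elim0, Or.inl hf, h⟩
  | false, hf => exact Submodule.subset_span ⟨f, hf, 0, fun i => i.elim0, h⟩

theorem ι_mul_mem_extLevel {p q : Bool} {x : L} (hx : x ∈ CL.level p) {n : ℕ}
    {z : ExteriorAlgebra A L} (hz : z ∈ CL.extLevel q n) :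
    ι A x * z ∈ CL.extLevel (p || q) (n + 1) := by
  have hgen : ∀ (f : A) (y : Fin n → L), ι A x * f • ιMulti A n y =
      f • ιMulti A (n + 1) (Fin.cons x y : Fin (n + 1) → L) := by
    intro f y
    rw [ιMulti_succ_apply, mul_smul_comm]
    rfl
  have hW : ∀ y : Fin n → L, (∀ i, y i ∈ CL.W) →
      ∀ i, (Fin.cons x y : Fin (n + 1) → L) i ∈ CL.W := by
    intro y hy i
    cases i using Fin.cases with
    | zero => exact mem_W_of_mem_level hx
    | succ i => exact hy i
  have key : CL.extLevel q n ≤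
      (CL.extLevel (p || q) (n + 1)).comap (LinearMap.mulLeft 𝕜 (ι A x)) := by
    match q with
    | false =>
      refine Submodule.span_le.mpr ?_
      rintro _ ⟨f, hf, y, hy, rfl⟩
      change ι A x * f • ιMulti A n y ∈ CL.extLevel (p || false) (n + 1)
      rw [hgen]
      match p, hx with
      | true, hx => exact Submodule.subset_span ⟨f, hf, _, hW y hy, Or.inr ⟨0, hx⟩, rfl⟩
      | false, hx => exact Submodule.subset_span ⟨f, hf, _, hW y hy, rfl⟩
    | true =>
      refine Submodule.span_le.mpr ?_
      rintro _ ⟨f, hf, y, hy, hfy, rfl⟩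
      change ι A x * f • ιMulti A n y ∈ CL.extLevel (p || true) (n + 1)
      rw [hgen, Bool.or_true]
      exact Submodule.subset_span ⟨f, hf, _, hW y hy,
        hfy.imp id fun ⟨i, hi⟩ => ⟨i.succ, hi⟩, rfl⟩
  exact key hz

/-- Induction on the components of the exterior algebra by left multiplication with vectors. -/
@[elab_as_elim]
theorem extLevel_induction
    {P : (p : Bool) → (n : ℕ) → (z : ExteriorAlgebra A L) → z ∈ CL.extLevel p n → Prop}
    (algebraMap : ∀ (p : Bool) (f : A) (hf : f ∈ CA.level p),
      P p 0 (algebraMap A _ f) (algebraMap_mem_extLevel hf))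
    (add : ∀ p n z w hz hw, P p n z hz → P p n w hw → P p n (z + w) (add_mem hz hw))
    (smul : ∀ p n (c : 𝕜) z hz, P p n z hz → P p n (c • z) (Submodule.smul_mem _ c hz))
    (ι_mul : ∀ p q n x z (hx : x ∈ CL.level p) (hz : z ∈ CL.extLevel q n), P q n z hz →
      P (p || q) (n + 1) (ι A x * z) (ι_mul_mem_extLevel hx hz))
    {p : Bool} {n : ℕ} {z : ExteriorAlgebra A L} (hz : z ∈ CL.extLevel p n) : P p n z hz := by
  -- Vectors are peeled off a generator one at a time, the coefficient staying with the tail down to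
  -- degree zero.
  have hgenW : ∀ (n : ℕ) (f : A) (x : Fin n → L), f ∈ CA.W → (∀ i, x i ∈ CL.W) →
      ∃ h, P false n (f • ιMulti A n x) h := by
    intro n
    induction n with
    | zero =>
      intro f x hf _
      rw [ιMulti_zero_apply, ← Algebra.algebraMap_eq_smul_one]
      exact ⟨_, algebraMap false f hf⟩
    | succ n ih =>
      intro f x hf hx
      rw [ιMulti_succ_apply, ← mul_smul_comm]
      obtain ⟨h, h'⟩ := ih f (Matrix.vecTail x) hf fun i => hx i.succ
      exact ⟨_, ι_mul false false n _ _ (hx 0) h h'⟩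
  have hgenN : ∀ (n : ℕ) (f : A) (x : Fin n → L), f ∈ CA.W → (∀ i, x i ∈ CL.W) →
      (f ∈ CA.N ∨ ∃ i, x i ∈ CL.N) → ∃ h, P true n (f • ιMulti A n x) h := by
    intro n
    induction n with
    | zero =>
      intro f x _ _ hf
      obtain hf | ⟨i, -⟩ := hf
      · rw [ιMulti_zero_apply, ← Algebra.algebraMap_eq_smul_one]
        exact ⟨_, algebraMap true f hf⟩
      · exact i.elim0
    | succ n ih =>
      intro f x hf hx hfx
      rw [ιMulti_succ_apply, ← mul_smul_comm]
      -- A leading null vector makes the whole product null, so the tail need only lie in `W`.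
      -- Otherwise the null factor is the coefficient or sits in the tail.
      by_cases h0 : x 0 ∈ CL.N
      · obtain ⟨h, h'⟩ := hgenW n f (Matrix.vecTail x) hf fun i => hx i.succ
        exact ⟨_, ι_mul true false n _ _ h0 h h'⟩
      · obtain ⟨h, h'⟩ := ih f (Matrix.vecTail x) hf (fun i => hx i.succ) <| hfx.imp id <| by
          rintro ⟨i, hi⟩
          cases i using Fin.cases with
          | zero => exact absurd hi h0
          | succ i => exact ⟨i, hi⟩
        exact ⟨_, ι_mul false true n _ _ (hx 0) h h'⟩
  -- Zero is the generator with coefficient `0`, which lies in `A_N`, so it needs no separate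
  -- induction hypothesis.
  have hzero : ∀ p n, P p n 0 (zero_mem _) := by
    intro p n
    have hW := hgenW n 0 0 (zero_mem _) fun _ => zero_mem _
    have hN := hgenN n 0 0 (zero_mem _) (fun _ => zero_mem _) (Or.inl (zero_mem _))
    simp only [zero_smul] at hW hN
    match p with
    | true => exact hN.2
    | false => exact hW.2
  match p, hz with
  | true, hz =>
    refine Submodule.span_induction (p := P true n) ?_ (hzero true n) (fun z w => add true n z w)
      (fun c z => smul true n c z) hz
    rintro _ ⟨f, hf, x, hx, hfx, rfl⟩
    exact (hgenN n f x hf hx hfx).2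
  | false, hz =>
    refine Submodule.span_induction (p := P false n) ?_ (hzero false n) (fun z w => add false n z w)
      (fun c z => smul false n c z) hz
    rintro _ ⟨f, hf, x, hx, rfl⟩
    exact (hgenW n f x hf hx).2

theorem ι_mul_mem_extLevelInt {p q : Bool} {x : L} (hx : x ∈ CL.level p) {i : ℤ}
    {z : ExteriorAlgebra A L} (hz : z ∈ CL.extLevelInt q i) :
    ι A x * z ∈ CL.extLevelInt (p || q) (i + 1) := by
  obtain rfl | ⟨n, rfl, hz⟩ := mem_extendGrading_iff.mp hz
  · rw [mul_zero]
    exact zero_mem _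
  · exact mem_extendGrading_of_mem (ι_mul_mem_extLevel hx hz) rfl

theorem smul_mem_extLevel {p q : Bool} {f : A} (hf : f ∈ CA.level p) {n : ℕ}
    {z : ExteriorAlgebra A L} (hz : z ∈ CL.extLevel q n) : f • z ∈ CL.extLevel (p || q) n := by
  induction hz using extLevel_induction with
  | algebraMap q g hg =>
    rw [Algebra.smul_def, ← map_mul]
    exact algebraMap_mem_extLevel (ConstraintAlgebra.mul_mem_level hf hg)
  | add q n z w _ _ hz hw => rw [smul_add]; exact add_mem hz hw
  | smul q n c z _ hz => rw [smul_comm]; exact Submodule.smul_mem _ c hz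
  | ι_mul q r n x z hx _ hz =>
    rw [← mul_smul_comm, Bool.or_left_comm]
    exact ι_mul_mem_extLevel hx hz

theorem smul_mem_extLevelInt {p q : Bool} {f : A} (hf : f ∈ CA.level p) {i : ℤ}
    {z : ExteriorAlgebra A L} (hz : z ∈ CL.extLevelInt q i) :
    f • z ∈ CL.extLevelInt (p || q) i := by
  obtain rfl | ⟨n, rfl, hz⟩ := mem_extendGrading_iff.mp hz
  · rw [smul_zero]
    exact zero_mem _
  · exact mem_extendGrading_of_mem (smul_mem_extLevel hf hz) rfl

theorem extLevel_le_exteriorPower (p : Bool) {n : ℕ} {z : ExteriorAlgebra A L}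
    (hz : z ∈ CL.extLevel p n) : z ∈ ⋀[A]^n L := by
  induction hz using extLevel_induction with
  | algebraMap q g hg => exact algebraMap_mem_zero g
  | add q n z w _ _ hz hw => exact add_mem hz hw
  | smul q n c z _ hz => exact Submodule.smul_of_tower_mem _ c hz
  | ι_mul q r n x z hx _ hz => exact ι_mul_mem x hz

theorem mul_mem_extLevelInt {p q : Bool} {m : ℕ} {j : ℤ} {a b : ExteriorAlgebra A L}
    (ha : a ∈ CL.extLevel p m) (hb : b ∈ CL.extLevelInt q j) :
    a * b ∈ CL.extLevelInt (p || q) (m + j) := by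
  induction ha using extLevel_induction with
  | algebraMap r g hg =>
    rw [← Algebra.smul_def, Nat.cast_zero, zero_add]
    exact smul_mem_extLevelInt hg hb
  | add r n z w _ _ hz hw => rw [add_mul]; exact add_mem hz hw
  | smul r n c z _ hz => rw [smul_mul_assoc]; exact Submodule.smul_mem _ c hz
  | ι_mul r s n x z hx _ hz =>
    rw [mul_assoc, Bool.or_assoc, Nat.cast_succ, add_right_comm]
    exact ι_mul_mem_extLevelInt hx hz

theorem involute_mem_extLevel {p : Bool} {n : ℕ} {z : ExteriorAlgebra A L}
    (hz : z ∈ CL.extLevel p n) : involute z ∈ CL.extLevel p n := by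
  rw [involute_of_mem (extLevel_le_exteriorPower p hz)]
  obtain h | h := neg_one_pow_eq_or A n
  · rwa [h, one_smul]
  · rw [h, neg_one_smul]
    exact neg_mem hz

theorem lieDerivative_mem_extLevel {p q : Bool} {x : L} (hx : x ∈ CL.level p) {n : ℕ}
    {z : ExteriorAlgebra A L} (hz : z ∈ CL.extLevel q n) :
    lieDerivative 𝕜 x z ∈ CL.extLevel (p || q) n := by
  induction hz using extLevel_induction with
  | algebraMap r g hg =>
    rw [lieDerivative_algebraMap]
    exact algebraMap_mem_extLevel (anchor_mem_level hx hg)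
  | add r n z w _ _ hz hw => rw [map_add]; exact add_mem hz hw
  | smul r n c z _ hz => rw [map_smul]; exact Submodule.smul_mem _ c hz
  | ι_mul r s n y z hy hz ih =>
    rw [lieDerivative_ι_mul]
    refine add_mem ?_ ?_
    · rw [← Bool.or_assoc]
      exact ι_mul_mem_extLevel (lie_mem_level hx hy) hz
    · rw [Bool.or_left_comm]
      exact ι_mul_mem_extLevel hy ih

/-- Integer degrees make `n - 1` correct at `n = 0`, where the component of degree `-1` is zero. -/
theorem contractFun_mem_extLevelInt {p q : Bool} {f : A} (hf : f ∈ CA.level p) {n : ℕ}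
    {z : ExteriorAlgebra A L} (hz : z ∈ CL.extLevel q n) :
    contractFun L f z ∈ CL.extLevelInt (p || q) (n - 1) := by
  induction hz using extLevel_induction with
  | algebraMap r g hg =>
    rw [contractFun_algebraMap]
    exact zero_mem _
  | add r n z w _ _ hz hw => rw [map_add]; exact add_mem hz hw
  | smul r n c z _ hz =>
    rw [LinearMap.map_smul_of_tower]
    exact Submodule.smul_mem _ c hz
  | ι_mul r s n y z hy hz ih =>
    rw [contractFun_ι_mul]
    refine sub_mem ?_ ?_
    · have := smul_mem_extLevel (anchor_mem_level hy hf) hz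
      rw [Bool.or_comm r p, Bool.or_assoc] at this
      exact mem_extendGrading_of_mem this (by simp)
    · have := ι_mul_mem_extLevelInt hy ih
      rw [Bool.or_left_comm] at this
      simpa using this

theorem schouten_mem_extLevelInt {p q : Bool} {m n : ℕ} {a b : ExteriorAlgebra A L}
    (ha : a ∈ CL.extLevel p m) (hb : b ∈ CL.extLevel q n) :
    schouten 𝕜 a b ∈ CL.extLevelInt (p || q) (m + n - 1) := by
  induction ha using extLevel_induction with
  | algebraMap r g hg =>
    rw [schouten_algebraMap, Nat.cast_zero, zero_add]
    exact neg_mem (contractFun_mem_extLevelInt hg hb)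
  | add r n z w _ _ hz hw => rw [map_add]; exact add_mem hz hw
  | smul r n c z _ hz => rw [map_smul]; exact Submodule.smul_mem _ c hz
  | ι_mul r s m x z hx hz ih =>
    rw [schouten_ι_mul]
    refine add_mem ?_ ?_
    · have := ι_mul_mem_extLevelInt hx ih
      rw [← Bool.or_assoc] at this
      convert this using 2
      push_cast
      ring
    · have := mul_mem_extLevelInt (involute_mem_extLevel hz)
        (mem_extendGrading_of_mem (lieDerivative_mem_extLevel hx hb) rfl)
      rw [Bool.or_left_comm, ← Bool.or_assoc] at this
      convert this using 2
      push_cast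
      ring

end ConstraintLieRinehart

open CliffordAlgebra (contractLeft involute)
open ExteriorAlgebra LieRinehartAlgebra

/-- Translates signs with integer exponents into powers of `-1` in `A`; only parity matters, so `i -
1` may be replaced by `i + 1`. -/
theorem negOnePow_smul_eq (A : Type*) {V : Type*} [CommRing A] [AddCommGroup V] [Module A V]
    {i : ℤ} {k : ℕ} (h : Even (i - k)) (v : V) : i.negOnePow • v = (-1 : A) ^ k • v := by
  rw [(Int.negOnePow_eq_iff i k).mpr h]
  obtain h | h := Nat.even_or_odd k
  · rw [Int.negOnePow_even _ (by exact_mod_cast h), h.neg_one_pow, one_smul, one_smul]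
  · rw [Int.negOnePow_odd _ (by exact_mod_cast h), h.neg_one_pow, neg_one_smul, Units.neg_smul,
      one_smul]

/-! ### Constraint components of the Chevalley–Eilenberg complex -/

namespace ConstraintLieRinehart

variable {𝕜 A : Type*} [Field 𝕜] [CommRing A] [Algebra 𝕜 A] {CA : ConstraintAlgebra 𝕜 A}
  {L : Type*} [LieRing L] [Module A L] [LieRingModule L A]
  [LieRinehartRing A L] [LieAlgebra 𝕜 L] [LieRinehartAlgebra 𝕜 A L]
  (CL : ConstraintLieRinehart CA L)

/-- The `N`-component (for `true`) and the `W`-component (for `false`) of the Chevalley–Eilenberg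
complex. -/
def CELevel : Bool → ℕ → Submodule 𝕜 (CEModule A L)
  | true => CL.CEN
  | false => CL.CEW

/-- The components `CELevel`, indexed by integers. -/
def CELevelInt (p : Bool) : ℤ → Submodule 𝕜 (CEModule A L) :=
  extendGrading (CL.CELevel p)

variable {CL}

/-- The internal Hom in level form. For `p = true` the condition on the null part is automatic,
since `Λ_N ⊆ Λ_W`. -/
theorem mem_CELevel_iff {p : Bool} {n : ℕ} {φ : CEModule A L} :
    φ ∈ CL.CELevel p n ↔ φ ∈ CEDegree 𝕜 A L n ∧
      ∀ q, ∀ z ∈ CL.extLevel q n, φ.toDual z ∈ CA.level (p || q) :=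
  match p with
  | true => ⟨fun h => ⟨h.1, fun q z hz => match q, hz with
      | true, hz => h.2 z (extLevel_true_le n hz)
      | false, hz => h.2 z hz⟩, fun h => ⟨h.1, h.2 false⟩⟩
  | false => ⟨fun h => ⟨h.1, fun q z hz => match q, hz with
      | true, hz => h.2.2 z hz
      | false, hz => h.2.1 z hz⟩, fun h => ⟨h.1, h.2 false, h.2 true⟩⟩

theorem CEInsert_eq_zero (x : L) {φ : CEModule A L} (hφ : φ ∈ CEDegree 𝕜 A L 0) :
    CEInsert x φ = 0 := by
  refine CEModule.ext fun z => ?_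
  rw [map_zero, LinearMap.zero_apply, toDual_CEInsert]
  induction z using DirectSum.Decomposition.inductionOn fun i : ℕ => ⋀[A]^i L with
  | zero => rw [mul_zero, map_zero]
  | homogeneous z => exact hφ _ (Nat.succ_ne_zero _) _ (ι_mul_mem x z.2)
  | add z w hz hw => rw [mul_add, map_add, hz, hw, add_zero]

theorem CEInsert_mem_CELevel {p q : Bool} {x : L} (hx : x ∈ CL.level p) {n : ℕ}
    {φ : CEModule A L} (hφ : φ ∈ CL.CELevel q (n + 1)) : CEInsert x φ ∈ CL.CELevel (p || q) n := by
  rw [mem_CELevel_iff] at hφ ⊢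
  refine ⟨fun m hm z hz => hφ.1 (m + 1) (by omega) _ (ι_mul_mem x hz), fun r z hz => ?_⟩
  have := hφ.2 _ _ (ι_mul_mem_extLevel hx hz)
  rwa [Bool.or_left_comm, ← Bool.or_assoc] at this

theorem CEInsert_mem_CELevelInt {p q : Bool} {x : L} (hx : x ∈ CL.level p) {i : ℤ}
    {φ : CEModule A L} (hφ : φ ∈ CL.CELevelInt q i) :
    CEInsert x φ ∈ CL.CELevelInt (p || q) (i - 1) := by
  obtain rfl | ⟨n, rfl, hφ⟩ := mem_extendGrading_iff.mp hφ
  · rw [map_zero]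
    exact zero_mem _
  obtain rfl | n := n
  · rw [CEInsert_eq_zero x (mem_CELevel_iff.mp hφ).1]
    exact zero_mem _
  · exact mem_extendGrading_of_mem (CEInsert_mem_CELevel hx hφ) (by simp)

theorem smul_mem_CELevelInt {p q : Bool} {f : A} (hf : f ∈ CA.level p) {i : ℤ}
    {φ : CEModule A L} (hφ : φ ∈ CL.CELevelInt q i) : f • φ ∈ CL.CELevelInt (p || q) i := by
  obtain rfl | ⟨n, rfl, hφ'⟩ := mem_extendGrading_iff.mp hφ
  · rw [smul_zero]
    exact zero_mem _
  refine mem_extendGrading_of_mem ?_ rfl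
  rw [mem_CELevel_iff] at hφ' ⊢
  refine ⟨fun m hm z hz => ?_, fun r z hz => ?_⟩
  · rw [map_smul, LinearMap.smul_apply, hφ'.1 m hm z hz, smul_zero]
  · rw [map_smul, LinearMap.smul_apply, Bool.or_assoc]
    exact ConstraintAlgebra.mul_mem_level hf (hφ'.2 r z hz)

theorem CEContract_mem_CELevelInt {p q : Bool} {m : ℕ} {a : ExteriorAlgebra A L}
    (ha : a ∈ CL.extLevel p m) {j : ℤ} {φ : CEModule A L} (hφ : φ ∈ CL.CELevelInt q j) :
    CEContract 𝕜 A L a φ ∈ CL.CELevelInt (p || q) (j - m) := by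
  induction ha using extLevel_induction with
  | algebraMap r g hg =>
    rw [CEContract_algebraMap, Nat.cast_zero, sub_zero]
    exact smul_mem_CELevelInt hg hφ
  | add r n z w _ _ hz hw => rw [map_add]; exact add_mem hz hw
  | smul r n c z _ hz => rw [map_smul]; exact Submodule.smul_mem _ c hz
  | ι_mul r s m x z hx _ ih =>
    rw [CEContract_ι_mul, Bool.or_assoc, Nat.cast_succ, ← sub_sub]
    exact CEInsert_mem_CELevelInt hx ih

theorem toDual_differential_eq_zero {m : ℕ} {z : ExteriorAlgebra A L} (hz : z ∈ ⋀[A]^m L)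
    {n : ℕ} {φ : CEModule A L} (hφ : φ ∈ CEDegree 𝕜 A L n) (h : m ≠ n + 1) :
    (differential 𝕜 A L φ).toDual z = 0 := by
  induction hz using homogeneous_induction generalizing n φ with
  | algebraMap f =>
    rw [Algebra.algebraMap_eq_smul_one, map_smul, toDual_differential_one, smul_zero]
  | add m a b _ _ ha hb => rw [map_add, ha hφ h, hb hφ h, add_zero]
  | ι_mul m a x ha ih =>
    rw [toDual_differential_ι_mul, hφ m (by omega) a ha,
      hφ m (by omega) _ (lieDerivative_mem 𝕜 x ha), lie_zero, sub_zero, zero_sub, neg_eq_zero]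
    obtain rfl | n := n
    · rw [CEInsert_eq_zero x hφ, map_zero, map_zero, LinearMap.zero_apply]
    · exact ih (n := n) (fun k hk w hw => hφ (k + 1) (by omega) _ (ι_mul_mem x hw)) (by omega)

theorem differential_mem_CELevel {p : Bool} {n : ℕ} {φ : CEModule A L}
    (hφ : φ ∈ CL.CELevel p n) : differential 𝕜 A L φ ∈ CL.CELevel p (n + 1) := by
  refine mem_CELevel_iff.mpr ⟨fun m hm z hz =>
    toDual_differential_eq_zero hz (mem_CELevel_iff.mp hφ).1 hm, fun q z hz => ?_⟩
  -- The induction needs a free degree index and must range over all `φ` and `p`: the step passes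
  -- from `φ` to its insertion, which has smaller degree and possibly another level.
  generalize hk : n + 1 = k at hz
  induction hz using extLevel_induction generalizing n p φ with
  | algebraMap r g hg => exact absurd hk (Nat.succ_ne_zero n)
  | add r k z w _ _ hz hw => rw [map_add]; exact add_mem (hz hφ hk) (hw hφ hk)
  | smul r k c z _ hz =>
    rw [LinearMap.map_smul_of_tower]
    exact Submodule.smul_mem _ c (hz hφ hk)
  | ι_mul r s k x z hx hz ih =>
    obtain rfl : n = k := by omega
    have hφ' := (mem_CELevel_iff.mp hφ).2
    rw [toDual_differential_ι_mul]
    refine sub_mem (sub_mem ?_ ?_) ?_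
    · rw [Bool.or_left_comm]
      exact anchor_mem_level hx (hφ' s z hz)
    · exact hφ' _ _ (lieDerivative_mem_extLevel hx hz)
    · obtain rfl | n := n
      · rw [CEInsert_eq_zero x (mem_CELevel_iff.mp hφ).1, map_zero, map_zero,
          LinearMap.zero_apply]
        exact zero_mem _
      · have := ih (CEInsert_mem_CELevel hx hφ) rfl
        rwa [Bool.or_comm r p, Bool.or_assoc] at this

theorem differential_mem_CELevelInt {p : Bool} {i : ℤ} {φ : CEModule A L}
    (hφ : φ ∈ CL.CELevelInt p i) : differential 𝕜 A L φ ∈ CL.CELevelInt p (i + 1) := by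
  obtain rfl | ⟨n, rfl, hφ⟩ := mem_extendGrading_iff.mp hφ
  · rw [map_zero]
    exact zero_mem _
  · exact mem_extendGrading_of_mem (differential_mem_CELevel hφ) rfl

theorem CELie_mem_CELevelInt {p q : Bool} {m : ℕ} {a : ExteriorAlgebra A L}
    (ha : a ∈ CL.extLevel p m) {j : ℤ} {φ : CEModule A L} (hφ : φ ∈ CL.CELevelInt q j) :
    CELie (differential 𝕜 A L) a φ ∈ CL.CELevelInt (p || q) (j + 1 - m) := by
  rw [CELie_apply]
  refine sub_mem (CEContract_mem_CELevelInt ha (differential_mem_CELevelInt hφ)) ?_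
  have := differential_mem_CELevelInt (CEContract_mem_CELevelInt (involute_mem_extLevel ha) hφ)
  rwa [sub_add_eq_add_sub] at this

/-! ### The components of the trivial constraint structure -/

/-- With every component total, the constraint estimates specialize to plain degree statements,
which then need no separate proof. -/
theorem extLevel_trivial (p : Bool) (n : ℕ) :
    (trivial 𝕜 A L).extLevel p n = (⋀[A]^n L).restrictScalars 𝕜 := by
  refine le_antisymm (fun z hz => extLevel_le_exteriorPower p hz) fun z hz => ?_
  have hz' : z ∈ ⋀[A]^n L := hz
  have hA : ∀ p (f : A), f ∈ (ConstraintAlgebra.trivial 𝕜 A).level p := fun p f =>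
    match p with
    | true => Submodule.mem_top
    | false => Algebra.mem_top (R := 𝕜)
  have hL : ∀ p (x : L), x ∈ (trivial 𝕜 A L).level p := fun p x =>
    match p with
    | true => Submodule.mem_top
    | false => Submodule.mem_top
  induction hz' using homogeneous_induction with
  | algebraMap f => exact algebraMap_mem_extLevel (hA p f)
  | add n a b ha hb iha ihb => exact add_mem (iha ha) (ihb hb)
  | ι_mul n a x ha ih =>
    have := ι_mul_mem_extLevel (hL p x) (ih ha)
    rwa [Bool.or_self] at this

theorem CELevel_trivial (p : Bool) (n : ℕ) :
    (trivial 𝕜 A L).CELevel p n = CEDegree 𝕜 A L n := by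
  ext φ
  rw [mem_CELevel_iff]
  refine ⟨fun h => h.1, fun h => ⟨h, fun q z _ => ?_⟩⟩
  match p || q with
  | true => exact Submodule.mem_top
  | false => exact Algebra.mem_top (R := 𝕜)

theorem extLevelInt_trivial (p : Bool) (i : ℤ) :
    (trivial 𝕜 A L).extLevelInt p i =
      extendGrading (fun n => (⋀[A]^n L).restrictScalars 𝕜) i := by
  rw [extLevelInt, funext (extLevel_trivial p)]

theorem CELevelInt_trivial (p : Bool) (i : ℤ) :
    (trivial 𝕜 A L).CELevelInt p i = extendGrading (CEDegree 𝕜 A L) i := by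
  rw [CELevelInt, funext (CELevel_trivial p)]

section IntDegrees

variable {p q : Bool} {i j : ℤ} {a b : ExteriorAlgebra A L} {φ : CEModule A L}

theorem mul_mem_int (ha : a ∈ CL.extLevelInt p i) (hb : b ∈ CL.extLevelInt q j) :
    a * b ∈ CL.extLevelInt (p || q) (i + j) := by
  obtain rfl | ⟨m, rfl, ha⟩ := mem_extendGrading_iff.mp ha
  · rw [zero_mul]
    exact zero_mem _
  · exact mul_mem_extLevelInt ha hb

theorem schouten_mem_int (ha : a ∈ CL.extLevelInt p i) (hb : b ∈ CL.extLevelInt q j) :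
    schouten 𝕜 a b ∈ CL.extLevelInt (p || q) (i + j - 1) := by
  obtain rfl | ⟨m, rfl, ha⟩ := mem_extendGrading_iff.mp ha
  · rw [map_zero]
    exact zero_mem _
  obtain rfl | ⟨n, rfl, hb⟩ := mem_extendGrading_iff.mp hb
  · rw [map_zero]
    exact zero_mem _
  · exact schouten_mem_extLevelInt ha hb

theorem CEContract_mem_int (ha : a ∈ CL.extLevelInt p i) (hφ : φ ∈ CL.CELevelInt q j) :
    CEContract 𝕜 A L a φ ∈ CL.CELevelInt (p || q) (j - i) := by
  obtain rfl | ⟨m, rfl, ha⟩ := mem_extendGrading_iff.mp ha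
  · rw [map_zero]
    exact zero_mem _
  · exact CEContract_mem_CELevelInt ha hφ

theorem CELie_mem_int (ha : a ∈ CL.extLevelInt p i) (hφ : φ ∈ CL.CELevelInt q j) :
    CELie (differential 𝕜 A L) a φ ∈ CL.CELevelInt (p || q) (j + 1 - i) := by
  obtain rfl | ⟨m, rfl, ha⟩ := mem_extendGrading_iff.mp ha
  · rw [map_zero]
    exact zero_mem _
  · exact CELie_mem_CELevelInt ha hφ

end IntDegrees

end ConstraintLieRinehart

/-! ### Assembly of the Gerstenhaber and BV structures -/

namespace LieRinehartAlgebra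

open ConstraintLieRinehart

variable (𝕜 A L : Type*) [Field 𝕜] [CommRing A] [Algebra 𝕜 A] [LieRing L] [Module A L]
  [LieRingModule L A] [LieRinehartRing A L] [LieAlgebra 𝕜 L] [LieRinehartAlgebra 𝕜 A L]

/-- The exterior powers as a grading by integers. -/
def exteriorGrading : ℤ → Submodule 𝕜 (ExteriorAlgebra A L) :=
  extendGrading fun n => (⋀[A]^n L).restrictScalars 𝕜

variable {𝕜 A L}

theorem mem_exteriorGrading_iff {i : ℤ} {a : ExteriorAlgebra A L} :
    a ∈ exteriorGrading 𝕜 A L i ↔ a = 0 ∨ ∃ n : ℕ, i = n ∧ a ∈ ⋀[A]^n L :=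
  mem_extendGrading_iff

theorem isGerstenhaberAlgebra_schouten :
    IsGerstenhaberAlgebra (exteriorGrading 𝕜 A L) (schouten 𝕜) where
  isInternal := (trivial 𝕜 A L).exterior.isInternal
  one_mem := mem_extendGrading_of_mem (n := 0)
    (by simp) rfl
  mul_mem i j a ha b hb := by
    rw [exteriorGrading, ← extLevelInt_trivial false] at *
    exact mul_mem_int ha hb
  mul_comm i j a ha b hb := by
    obtain rfl | ⟨m, rfl, ha⟩ := mem_exteriorGrading_iff.mp ha
    · simp
    obtain rfl | ⟨n, rfl, hb⟩ := mem_exteriorGrading_iff.mp hb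
    · simp
    rw [negOnePow_smul_eq A (k := m * n) (by simp), mul_comm_of_mem ha hb]
  br_mem i j a ha b hb := by
    rw [exteriorGrading, ← extLevelInt_trivial false] at *
    exact schouten_mem_int ha hb
  br_antisymm i j a ha b hb := by
    obtain rfl | ⟨m, rfl, ha⟩ := mem_exteriorGrading_iff.mp ha
    · simp
    obtain rfl | ⟨n, rfl, hb⟩ := mem_exteriorGrading_iff.mp hb
    · simp
    -- The shifted degrees `m - 1` and `n - 1` are replaced by `m + 1` and `n + 1`; the exponents
    -- differ by `-2(m + n)`.
    rw [negOnePow_smul_eq A (k := (m + 1) * (n + 1)) ⟨-(m + n), by push_cast; ring⟩,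
      schouten_antisymm 𝕜 ha hb]
  jacobi i j k a ha b hb c _ := by
    obtain rfl | ⟨m, rfl, ha⟩ := mem_exteriorGrading_iff.mp ha
    · simp
    obtain rfl | ⟨n, rfl, hb⟩ := mem_exteriorGrading_iff.mp hb
    · simp
    rw [negOnePow_smul_eq A (k := (m + 1) * (n + 1)) ⟨-(m + n), by push_cast; ring⟩,
      schouten_jacobi 𝕜 ha hb]
  leibniz i j k a ha b hb c _ := by
    obtain rfl | ⟨m, rfl, ha⟩ := mem_exteriorGrading_iff.mp ha
    · simp
    obtain rfl | ⟨n, rfl, hb⟩ := mem_exteriorGrading_iff.mp hb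
    · simp
    rw [negOnePow_smul_eq A (k := (m + 1) * n) ⟨-n, by push_cast; ring⟩,
      schouten_mul_of_mem 𝕜 ha hb]

theorem isBVModule_CEModule :
    IsBVModule (exteriorGrading 𝕜 A L) (schouten 𝕜) (extendGrading (CEDegree 𝕜 A L))
      (CEContract 𝕜 A L) (CELie (differential 𝕜 A L)) (differential 𝕜 A L) where
  isInternal := extendGrading_isInternal CEDegree_isInternal
  ι_mem i j a ha φ hφ := by
    rw [exteriorGrading, ← extLevelInt_trivial false] at ha
    rw [← CELevelInt_trivial false] at *
    exact CEContract_mem_int ha hφ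
  ι_one := CEContract_one 𝕜
  ι_mul := CEContract_mul 𝕜
  Lie_mem i j a ha φ hφ := by
    rw [exteriorGrading, ← extLevelInt_trivial false] at ha
    rw [← CELevelInt_trivial false] at *
    exact CELie_mem_int ha hφ
  Lie_br i j a ha b hb := by
    obtain rfl | ⟨m, rfl, ha⟩ := mem_exteriorGrading_iff.mp ha
    · simp
    obtain rfl | ⟨n, rfl, hb⟩ := mem_exteriorGrading_iff.mp hb
    · simp
    refine LinearMap.ext fun φ => (CELie_schouten 𝕜 ha hb φ).trans ?_
    rw [← negOnePow_smul_eq A (i := (m - 1) * (n - 1)) ⟨-(m + n), by push_cast; ring⟩]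
    rfl
  ι_br i j a ha b hb := by
    obtain rfl | ⟨m, rfl, ha⟩ := mem_exteriorGrading_iff.mp ha
    · simp
    obtain rfl | ⟨n, rfl, hb⟩ := mem_exteriorGrading_iff.mp hb
    · simp
    refine LinearMap.ext fun φ => (CEContract_schouten 𝕜 ha hb φ).trans ?_
    rw [← negOnePow_smul_eq A (i := (m - 1) * n) ⟨-n, by push_cast; ring⟩]
    rfl
  d_mem j φ hφ := by
    rw [← CELevelInt_trivial false] at *
    exact differential_mem_CELevelInt hφ
  d_d := LinearMap.ext (differential_differential 𝕜)
  cartan i a ha := by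
    obtain rfl | ⟨m, rfl, ha⟩ := mem_exteriorGrading_iff.mp ha
    · simp
    refine LinearMap.ext fun φ => (CELie_apply_of_mem 𝕜 _ ha φ).trans ?_
    rw [← negOnePow_smul_eq A (i := m) (by simp)]
    rfl
  ι_br' i j a ha b hb := by
    obtain rfl | ⟨m, rfl, ha⟩ := mem_exteriorGrading_iff.mp ha
    · simp
    obtain rfl | ⟨n, rfl, hb⟩ := mem_exteriorGrading_iff.mp hb
    · simp
    refine LinearMap.ext fun φ => (CEContract_schouten' 𝕜 ha hb φ).trans ?_
    rw [← negOnePow_smul_eq A (i := n - 1) ⟨-1, by push_cast; ring⟩,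
      ← negOnePow_smul_eq A (i := m * (n - 1)) ⟨-m, by push_cast; ring⟩]
    rfl
  Lie_mul i j a ha b hb := by
    obtain rfl | ⟨m, rfl, ha⟩ := mem_exteriorGrading_iff.mp ha
    · simp
    obtain rfl | ⟨n, rfl, hb⟩ := mem_exteriorGrading_iff.mp hb
    · simp
    refine LinearMap.ext fun φ => (CELie_mul 𝕜 ha hb φ).trans ?_
    rw [← negOnePow_smul_eq A (i := n) (by simp)]
    rfl

variable {CA : ConstraintAlgebra 𝕜 A} (CL : ConstraintLieRinehart CA L)

theorem isConstraintGerstenhaberAlgebra_schouten :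
    IsConstraintGerstenhaberAlgebra CL.exterior (schouten 𝕜) where
  total := isGerstenhaberAlgebra_schouten
  one_mem_W := by
    have := algebraMap_mem_extLevel (CL := CL) (p := false) (f := 1) (one_mem CA.W)
    rwa [map_one] at this
  mul_mem_W _ _ _ ha _ hb := mul_mem_int (CL := CL) (p := false) (q := false) ha hb
  mul_mem_N_left _ _ _ ha _ hb := mul_mem_int (CL := CL) (p := true) (q := false) ha hb
  mul_mem_N_right _ _ _ ha _ hb := mul_mem_int (CL := CL) (p := false) (q := true) ha hb
  br_mem_W _ _ _ ha _ hb := schouten_mem_int (CL := CL) (p := false) (q := false) ha hb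
  br_mem_N_left _ _ _ ha _ hb := schouten_mem_int (CL := CL) (p := true) (q := false) ha hb
  br_mem_N_right _ _ _ ha _ hb := schouten_mem_int (CL := CL) (p := false) (q := true) ha hb

theorem isConstraintBVModule_CE :
    IsConstraintBVModule CL.exterior (schouten 𝕜) CL.CE (CEContract 𝕜 A L)
      (CELie (differential 𝕜 A L)) (differential 𝕜 A L) where
  algebra := isConstraintGerstenhaberAlgebra_schouten CL
  total := isBVModule_CEModule
  ι_mem_W _ _ _ ha _ hφ := CEContract_mem_int (CL := CL) (p := false) (q := false) ha hφ
  ι_mem_N_left _ _ _ ha _ hφ := CEContract_mem_int (CL := CL) (p := true) (q := false) ha hφ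
  ι_mem_N_right _ _ _ ha _ hφ := CEContract_mem_int (CL := CL) (p := false) (q := true) ha hφ
  Lie_mem_W _ _ _ ha _ hφ := CELie_mem_int (CL := CL) (p := false) (q := false) ha hφ
  Lie_mem_N_left _ _ _ ha _ hφ := CELie_mem_int (CL := CL) (p := true) (q := false) ha hφ
  Lie_mem_N_right _ _ _ ha _ hφ := CELie_mem_int (CL := CL) (p := false) (q := true) ha hφ
  d_mem_W _ _ hφ := differential_mem_CELevelInt (CL := CL) (p := false) hφ
  d_mem_N _ _ hφ := differential_mem_CELevelInt (CL := CL) (p := true) hφ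

end LieRinehartAlgebra

theorem theoremB {𝕜 A L : Type*} [Field 𝕜] [CharZero 𝕜] [CommRing A] [Algebra 𝕜 A]
    [LieRing L] [Module A L] [LieRingModule L A] [LieRinehartRing A L] [LieAlgebra 𝕜 L]
    [LieRinehartAlgebra 𝕜 A L] (CA : ConstraintAlgebra 𝕜 A) (CL : ConstraintLieRinehart CA L) :
    (∃! br : ExteriorAlgebra A L →ₗ[𝕜] ExteriorAlgebra A L →ₗ[𝕜] ExteriorAlgebra A L,
      IsSchoutenNijenhuisBracket br) ∧
    (∃! d : Module.End 𝕜 (CEModule A L), IsCEDifferential d) ∧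
    ∀ (br : ExteriorAlgebra A L →ₗ[𝕜] ExteriorAlgebra A L →ₗ[𝕜] ExteriorAlgebra A L)
      (d : Module.End 𝕜 (CEModule A L)),
      IsSchoutenNijenhuisBracket br → IsCEDifferential d →
        IsConstraintGerstenhaberAlgebra CL.exterior br ∧
        IsConstraintBVModule CL.exterior br CL.CE (CEContract 𝕜 A L) (CELie d) d := by
  have hbr := isSchoutenNijenhuisBracket_schouten 𝕜 (A := A) (L := L)
  have hd := isCEDifferential_differential 𝕜 (A := A) (L := L)
  refine ⟨⟨_, hbr, fun br h => IsSchoutenNijenhuisBracket.unique h hbr⟩,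
    ⟨_, hd, fun d h => IsCEDifferential.unique h hd⟩, fun br d h h' => ?_⟩
  -- Uniqueness identifies the given operations with the constructed ones.
  obtain rfl := IsSchoutenNijenhuisBracket.unique h hbr
  obtain rfl := IsCEDifferential.unique h' hd
  exact ⟨isConstraintGerstenhaberAlgebra_schouten CL, isConstraintBVModule_CE CL⟩
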